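/- Let $q>2$ be a prime power and $t\ge 3$ an integer, and let $V$ be a $t$-dimensional vector space over $\mathbb F_{q^t}$, so that the points of $\mathrm{PG}(t-1,q^t)$ are the one-dimensional $\mathbb F_{q^t}$-subspaces $\langle v\rangle$ of $V$. Projective dimensions are used, the empty subspace having dimension $-1$. Let $\Sigma$ be a $q$-order canonical subgeometry of $\mathrm{PG}(t-1,q^t)$, that is, a set $\{\langle w\rangle : w\in W\setminus\{0\}\}$ that spans $\mathrm{PG}(t-1,q^t)$, where $W$ is a $t$-dimensional $\mathbb F_q$-subspace of $V$; a hyperplane of $\Sigma$ is a set $\{\langle u\rangle : u\in U\setminus\{0\}\}$ with $U$ a $(t-1)$-dimensional $\mathbb F_q$-subspace of $W$. Let $\Gamma$ be a $(t-3)$-dimensional subspace and $\ell_0$ a line of $\mathrm{PG}(t-1,q^t)$ with $\Sigma\cap\Gamma=\emptyset=\ell_0\cap\Gamma$. Put $$p_{\Gamma,\ell_0}(\Sigma)=\{\langle \Gamma,P\rangle\cap\ell_0 : P\in\Sigma\},$$ and let $G$ be the subgroup of $\mathrm{P\Gamma L}(t,q^t)$ fixing $\Sigma$ pointwise. A set $L$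 of points of $\ell_0$ is a scattered $\mathbb F_q$-linear set of rank $t$ if $L=\{\langle u\rangle : u\in U\setminus\{0\}\}$ for a $t$-dimensional $\mathbb F_q$-subspace $U$ of $V$ and $|L|=(q^t-1)/(q-1)$. It is of pseudoregulus type if it is the image of $$\mathbb L_0=\{\langle(\lambda,\lambda^q)\rangle : \lambda\in\mathbb F_{q^t}^*\}\subseteq \mathrm{PG}(1,q^t)$$ under some projectivity $\phi:\mathrm{PG}(1,q^t)\to\ell_0$. The transversal points of $L$ are the points $\langle(1,0)\rangle^\phi$ and $\langle(0,1)\rangle^\phi$, for all projectivities $\phi:\mathrm{PG}(1,q^t)\to\ell_0$ that map $\mathbb L_0$ to $L$. **Theorem.** The following assertions are equivalent: (i) $p_{\Gamma,\ell_0}(\Sigma)$ is a scattered $\mathbb F_q$-linear set (of rank $t$) of pseudoregulus type. (ii) There is a generator $\hat s$ of $G$ such that $\dim(\Gamma\cap\Gamma^{\hat s})=t-4$; furthermore, $\Gamma$ is not contained in the span of any hyperplane of $\Sigma$. (iii) There are a point $P_\Gamma$ and a generator $\hat s$ of $G$ such that $\langle P_\Gamma,P_\Gamma^{\hat s},\ldots,P_\Gamma^{\hat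 s^{t-1}}\rangle=\mathrm{PG}(t-1,q^t)$ and $$\Gamma=\langle P_\Gamma,P_\Gamma^{\hat s},\ldots,P_\Gamma^{\hat s^{t-3}}\rangle.\qquad(*)$$ Furthermore, if these conditions are satisfied, then (a) for any fixed generator $\hat s$ of $G$, there is at most one point $P_\Gamma$ satisfying $(*)$; (b) for any generator $\hat s$ of $G$ and any point $P_\Gamma$ satisfying $(*)$, the transversal points of $p_{\Gamma,\ell_0}(\Sigma)$ are precisely $\ell_0\cap\langle\Gamma,P_\Gamma^{\hat s^{i}}\rangle$, $i=t-2,t-1$. -/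

import Mathlib

namespace PseudoReg

/-- The collineation group `PΓL(V)` of `PG_K(V)`, as a group of permutations of the points: the
permutations induced by semilinear bijections of `V`. (If `dim V ≥ 2`, the action of `PΓL(V)` on
points is faithful, so nothing is lost by seeing it as a permutation group.) -/
def collineationGroup (K V : Type*) [Field K] [AddCommGroup V] [Module K V] :
    Subgroup (Equiv.Perm (Projectivization K V)) where
  carrier := {s | ∃ (σ : K ≃+* K) (f : V ≃+ V), (∀ (a : K) (v : V), f (a • v) = σ a • f v) ∧
    ∀ (v : V) (hv : v ≠ 0), s (Projectivization.mk K v hv) =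
      Projectivization.mk K (f v) (f.map_ne_zero_iff.mpr hv)}
  one_mem' := ⟨RingEquiv.refl K, AddEquiv.refl V, fun _ _ => rfl, fun _ _ => rfl⟩
  mul_mem' := by
    rintro s s' ⟨σ, f, hf, hs⟩ ⟨σ', f', hf', hs'⟩
    refine ⟨σ'.trans σ, f'.trans f, fun a v => ?_, fun v hv => ?_⟩
    · simp [hf, hf']
    · rw [Equiv.Perm.mul_apply, hs', hs]
      rfl
  inv_mem' := by
    rintro s ⟨σ, f, hf, hs⟩
    refine ⟨σ.symm, f.symm, fun a v => ?_, fun v hv => ?_⟩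
    · apply f.injective
      simp [hf]
    · rw [Equiv.Perm.inv_eq_iff_eq, hs]
      simp

/-- The subgroup of `PΓL(V)` fixing the point set `S` pointwise. -/
def pointwiseStabilizer {K V : Type*} [Field K] [AddCommGroup V] [Module K V]
    (S : Set (Projectivization K V)) : Subgroup (Equiv.Perm (Projectivization K V)) :=
  collineationGroup K V ⊓ fixingSubgroup (Equiv.Perm (Projectivization K V)) S

/-- `s` generates the (cyclic) subgroup of `PΓL(V)` fixing `S` pointwise. -/
def IsStabilizerGenerator {K V : Type*} [Field K] [AddCommGroup V] [Module K V]
    (S : Set (Projectivization K V)) (s : Equiv.Perm (Projectivization K V)) : Prop :=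
  Subgroup.zpowers s = pointwiseStabilizer S

/-- The projective subspace `⟨T⟩` spanned by a point set `T`. A projective subspace of projective
dimension `k` is represented by the corresponding vector subspace, which has dimension `k + 1`. -/
def spanPoints {K V : Type*} [Field K] [AddCommGroup V] [Module K V]
    (T : Set (Projectivization K V)) : Submodule K V :=
  ⨆ P ∈ T, P.submodule

/-- The image `Γ^s` of a projective subspace `Γ` under a collineation `s`: it is spanned by the
images of the points of `Γ`. -/
def imageSubspace {K V : Type*} [Field K] [AddCommGroup V] [Module K V]
    (s : Equiv.Perm (Projectivization K V)) (Γ : Submodule K V) : Submodule K V :=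
  spanPoints (s '' {P | P.submodule ≤ Γ})

/-- The projective subspace `⟨P, P^s, …, P^{s^{n-1}}⟩`. -/
def orbitSpan {K V : Type*} [Field K] [AddCommGroup V] [Module K V]
    (s : Equiv.Perm (Projectivization K V)) (P : Projectivization K V) (n : ℕ) :
    Submodule K V :=
  spanPoints {Q | ∃ i < n, Q = (s ^ i) P}

/-- The set `{⟨u⟩_K | u ∈ U, u ≠ 0}` of points of `PG_K(V)` given by an `F`-subspace `U` of `V`. -/
def linearPoints {F V : Type*} (K : Type*) [Field F] [Field K] [AddCommGroup V] [Module K V]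
    [Module F V] (U : Submodule F V) : Set (Projectivization K V) :=
  {P | ∃ (u : V) (hu : u ≠ 0), u ∈ U ∧ P = Projectivization.mk K u hu}

/-- `S` is the canonical subgeometry of `PG_K(V)` (of order `|F|`) given by the `F`-subspace `W`,
where `dim_F W = dim_K V`. -/
def IsSubgeometryOf {F K V : Type*} [Field F] [Field K] [AddCommGroup V] [Module K V]
    [Module F V] (W : Submodule F V) (S : Set (Projectivization K V)) : Prop :=
  Module.finrank F W = Module.finrank K V ∧ S = linearPoints K W ∧ spanPoints S = ⊤

/-- `S` is a canonical subgeometry of `PG_K(V)` of order `q = |F|`. -/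
def IsCanonicalSubgeometry (F : Type*) {K V : Type*} [Field F] [Field K] [AddCommGroup V]
    [Module K V] [Module F V] (S : Set (Projectivization K V)) : Prop :=
  ∃ W : Submodule F V, IsSubgeometryOf W S

/-- `H` is a hyperplane of the canonical subgeometry `S`. -/
def IsSubgeometryHyperplane (F : Type*) {K V : Type*} [Field F] [Field K] [AddCommGroup V]
    [Module K V] [Module F V] (S H : Set (Projectivization K V)) : Prop :=
  ∃ W U : Submodule F V, IsSubgeometryOf W S ∧ U ≤ W ∧
    Module.finrank F U + 1 = Module.finrank F W ∧ H = linearPoints K U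

/-- The projection `{⟨Γ, P⟩ ∩ Λ | P ∈ S}` of `S` from the center `Γ` to the axis `Λ`. -/
def projection {K V : Type*} [Field K] [AddCommGroup V] [Module K V]
    (Γ Λ : Submodule K V) (S : Set (Projectivization K V)) : Set (Projectivization K V) :=
  {Q | ∃ P ∈ S, Q.submodule = (Γ ⊔ P.submodule) ⊓ Λ}

/-- `L` is a scattered `F`-linear set of rank `n`: it is given by an `F`-subspace of dimension `n`
and has the maximal possible size `(qⁿ - 1) / (q - 1) = 1 + q + ⋯ + qⁿ⁻¹`, where `q = |F|`. -/
def IsScatteredLinearSet (F : Type*) {K V : Type*} [Field F] [Field K] [AddCommGroup V]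
    [Module K V] [Module F V] (n : ℕ) (L : Set (Projectivization K V)) : Prop :=
  (∃ U : Submodule F V, Module.finrank F U = n ∧ L = linearPoints K U) ∧
    L.ncard = ∑ i ∈ Finset.range n, Nat.card F ^ i

/-- The point set `{⟨(a, a^q)⟩ | a ∈ K, a ≠ 0}` of `PG_K(K²)`, where `q = |F|`. -/
def standardPseudoregulus (F K : Type*) [Field F] [Field K] :
    Set (Projectivization K (Fin 2 → K)) :=
  {P | ∃ (a : K) (h : (![a, a ^ Nat.card F] : Fin 2 → K) ≠ 0), P = Projectivization.mk K _ h}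

/-- The linear injection `f : K² → V` induces a projectivity from `PG_K(K²)` to the line `l` which
maps the standard set `{⟨(a, a^q)⟩ | a ≠ 0}` to `L`. -/
def IsPseudoregulusMap (F : Type*) {K V : Type*} [Field F] [Field K] [AddCommGroup V]
    [Module K V] (l : Submodule K V) (L : Set (Projectivization K V))
    (f : (Fin 2 → K) →ₗ[K] V) (hf : Function.Injective f) : Prop :=
  LinearMap.range f = l ∧ Projectivization.map f hf '' standardPseudoregulus F K = L

/-- The point set `L` on the line `l` is of pseudoregulus type: it is projectively equivalent to
`{⟨(a, a^q)⟩ | a ≠ 0}`. -/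
def IsPseudoregulusType (F : Type*) {K V : Type*} [Field F] [Field K] [AddCommGroup V]
    [Module K V] (l : Submodule K V) (L : Set (Projectivization K V)) : Prop :=
  ∃ (f : (Fin 2 → K) →ₗ[K] V) (hf : Function.Injective f), IsPseudoregulusMap F l L f hf

/-- `T` is a transversal point of the linear set `L` of pseudoregulus type on the line `l`: it is
the image of `⟨(1, 0)⟩` or of `⟨(0, 1)⟩` under some projectivity that maps
`{⟨(a, a^q)⟩ | a ≠ 0}` to `L`. -/
def IsTransversalPoint (F : Type*) {K V : Type*} [Field F] [Field K] [AddCommGroup V]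
    [Module K V] (l : Submodule K V) (L : Set (Projectivization K V))
    (T : Projectivization K V) : Prop :=
  ∃ (f : (Fin 2 → K) →ₗ[K] V) (hf : Function.Injective f), IsPseudoregulusMap F l L f hf ∧
    (T = Projectivization.map f hf (Projectivization.mk K ![1, 0] (by simp)) ∨
      T = Projectivization.map f hf (Projectivization.mk K ![0, 1] (by simp)))

end PseudoReg

/-! All three conditions say the same thing about `Γ`. The group `G` is the Galois group of K over F
acting on coordinates (`isStabilizerGenerator_iff`). Call a K-basis `E` of V, indexed by that Galois
group and permuted regularly by it, a Galois basis. In it the vectors of W are exactly those with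
coordinates (g x) for x in K. Each condition is equivalent to: `Γ` is the common kernel of the
coordinates of index 1 and σ, for some Galois basis and some generator σ.

For (iii), such a `Γ` is spanned by `E (σ ^ i)` for 2 ≤ i < t, so `P_Γ` is the point of `E (σ ^ 2)`.
For (ii), the dimension condition yields a functional c vanishing on `Γ` and on its image under the
inverse of σ. Then c and its σ-conjugate both vanish on `Γ`; the hyperplane condition makes them
independent, so they cut out `Γ`, and c generates the dual Galois basis. For the step to (i),
projecting along such a `Γ` gives the points ⟨(x, σ x)⟩, which form the standard set for every
generator σ by a telescoping product.

The hard step starts from (i). In the coordinates of the given projectivity, the projection is u ↦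
(a u, b u). The conjugates of a give a Galois basis, and on W one has b = ∑ c_g g(a). Equality with
the standard point set makes every (q-1)-th power of a nonzero element a value of (∑ c_g g(y))/y.
Hence det(D - diag(g(x^(q-1)))) vanishes for all nonzero x, where D is the Dickson matrix. Expanded
in principal minors, this is a polynomial in x of degree below q^t - 1, in which each proper
nonempty minor has its own exponent. So these minors vanish (`det_piecewise_dicksonMatrix_eq_zero`),
and a combinatorial argument on the zero pattern of D leaves one nonzero c_τ, with τ a generator.

For (a) and (b), a Galois basis with the same center and the same generator has the same vector of
index σ^2 up to a scalar. If the generators differ they are inverse to each other, and the two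
distinguished coordinates are only exchanged up to scalars. -/

set_option linter.unusedSectionVars false

/-! ### Principal minors and zero patterns of matrices. -/

namespace PseudoReg

open Finset Matrix

/-- Expansion of `det (M + diag d)` along the set of rows taken from `M`. -/
theorem det_add_diagonal_eq_sum {n R : Type*} [Fintype n] [DecidableEq n] [CommRing R]
    (M : Matrix n n R) (d : n → R) :
    (M + diagonal d).det =
      ∑ s : Finset n, (∏ i ∈ sᶜ, d i) * det (Matrix.of (s.piecewise M (1 : Matrix n n R))) := by
  have h := (detRowAlternating (n := n) (R := R)).map_add_univ M (diagonal d)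
  refine Eq.trans h (Finset.sum_congr rfl fun s _ => ?_)
  -- The rows outside `s` are multiples `d i` of rows of the identity; multilinearity extracts these
  -- factors.
  have h2 := (detRowAlternating (n := n) (R := R)).toMultilinearMap.map_piecewise_smul d
    (s.piecewise M (1 : Matrix n n R)) sᶜ
  rw [smul_eq_mul] at h2
  refine Eq.trans ?_ h2
  change det _ = det _
  congr 1
  ext i j
  by_cases hi : i ∈ s
  · simp [Finset.piecewise, hi]
  · simp [Finset.piecewise, hi, diagonal_apply, one_apply]

/-- If every row of `M` indexed by `s` has a nonzero entry in a column in `s`, then `M` has a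
nonzero principal minor with nonempty index set contained in `s`. -/
theorem exists_det_piecewise_ne_zero {n R : Type*} [Fintype n] [DecidableEq n] [CommRing R]
    [IsDomain R] (M : Matrix n n R) (s : Finset n) (hs : s.Nonempty)
    (h : ∀ i ∈ s, ∃ j ∈ s, M i j ≠ 0) :
    ∃ u ⊆ s, u.Nonempty ∧ det (Matrix.of (u.piecewise M (1 : Matrix n n R))) ≠ 0 := by
  obtain ⟨u, hus, hu⟩ := (Set.toFinite
    {u : Finset n | u.Nonempty ∧ ∀ i ∈ u, ∃ j ∈ u, M i j ≠ 0}).exists_le_minimal ⟨hs, h⟩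
  obtain ⟨⟨hne, hout⟩, hmin⟩ := hu
  -- The image of a selector `g` of nonzero entries again has the defining property of `u`, so
  -- minimality forces `g` to permute `u`.
  have himage : ∀ g : n → n, (∀ i ∈ u, g i ∈ u ∧ M i (g i) ≠ 0) → u.image g = u := by
    intro g hg
    have hsub : u.image g ⊆ u := by
      intro x hx
      obtain ⟨i, hi, rfl⟩ := mem_image.1 hx
      exact (hg i hi).1
    refine le_antisymm hsub (hmin ⟨hne.image g, ?_⟩ hsub)
    intro i hi
    exact ⟨g i, mem_image_of_mem g (hsub hi), (hg i (hsub hi)).2⟩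
  have hinj : ∀ g : n → n, (∀ i ∈ u, g i ∈ u ∧ M i (g i) ≠ 0) → Set.InjOn g u := fun g hg =>
    Finset.card_image_iff.1 (by rw [himage g hg])
  choose! g hgu hgM using hout
  have hg : ∀ i ∈ u, g i ∈ u ∧ M i (g i) ≠ 0 := fun i hi => ⟨hgu i hi, hgM i hi⟩
  -- With a second nonzero entry in row i, redirecting `g` at i alone would give a selector that is
  -- not injective.
  have huniq : ∀ i ∈ u, ∀ j ∈ u, M i j ≠ 0 → j = g i := by
    intro i hi j hj hij
    by_contra hne'
    have hg' : ∀ k ∈ u, Function.update g i j k ∈ u ∧ M k (Function.update g i j k) ≠ 0 := by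
      intro k hk
      by_cases hki : k = i
      · subst hki; simpa using ⟨hj, hij⟩
      · simpa [hki] using hg k hk
    obtain ⟨k, hk, hkj⟩ := mem_image.1 ((himage g hg).symm ▸ hj)
    have hki : k ≠ i := by rintro rfl; exact hne' hkj.symm
    exact hki (hinj _ hg' hk hi (by simp [hki, hkj]))
  have hbij : Function.Bijective (fun i => if i ∈ u then g i else i) := by
    refine Finite.injective_iff_bijective.1 fun a b hab => ?_
    by_cases ha : a ∈ u <;> by_cases hb : b ∈ u
    · simp only [ha, hb, if_true] at hab; exact hinj g hg ha hb hab
    · simp only [ha, hb, if_true, if_false] at hab; exact absurd (hab ▸ hgu a ha) hb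
    · simp only [ha, hb, if_true, if_false] at hab; exact absurd (hab ▸ hgu b hb) ha
    · simpa only [ha, hb, if_false] using hab
  refine ⟨u, hus, hne, ?_⟩
  -- Each row of `u` has a single nonzero entry in the columns of `u`, so the Leibniz sum has one
  -- nonzero term.
  rw [← det_transpose, det_apply, Finset.sum_eq_single (Equiv.ofBijective _ hbij)]
  · refine smul_ne_zero_iff_ne _ |>.2 (Finset.prod_ne_zero_iff.2 fun i _ => ?_)
    by_cases hi : i ∈ u
    · simpa [Finset.piecewise, hi] using hgM i hi
    · simp [Finset.piecewise, hi]
  · intro π _ hπ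
    by_contra hprod
    have hnz : ∀ i, u.piecewise M (1 : Matrix n n R) i (π i) ≠ 0 := by
      intro i hi
      apply hprod
      rw [Finset.prod_eq_zero (mem_univ i) (by simpa using hi), smul_zero]
    have hfix : ∀ i ∉ u, π i = i := by
      intro i hi
      by_contra hne'
      have := hnz i
      simp [Finset.piecewise, hi, one_apply, Ne.symm hne'] at this
    apply hπ
    ext i
    by_cases hi : i ∈ u
    · have hπi : π i ∈ u := by
        by_contra hc
        exact hc (by rw [π.injective (hfix _ hc)]; exact hi)
      have := hnz i
      simp only [Finset.piecewise, hi, if_true] at this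
      simpa [hi] using huniq i hi _ hπi this
    · simp [hi, hfix i hi]
  · simp

end PseudoReg

/-! ### Dickson matrices and q-polynomials whose eigenvalues include all (q-1)-th powers. -/

namespace PseudoReg

open Finset Matrix

/-- The elements of `Gal(K/F)`, for finite `K`, act as the powers `x ↦ x ^ |F| ^ i` with
`i < [K : F]`. -/
theorem exists_galois_exponent (F K : Type*) [Field F] [Finite F] [Field K] [Algebra F K]
    [FiniteDimensional F K] :
    ∃ n : (K ≃ₐ[F] K) → ℕ, Function.Injective n ∧ (∀ g, n g < Module.finrank F K) ∧
      ∀ g x, g x = x ^ Nat.card F ^ n g := by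
  have := Fintype.ofFinite F
  have : Finite K := Module.finite_of_finite F
  have hb := FiniteField.bijective_frobeniusAlgEquivOfAlgebraic_pow F K
  let e := Equiv.ofBijective _ hb
  refine ⟨fun g => (e.symm g).1, fun g h hgh => e.symm.injective (Fin.ext hgh),
    fun g => (e.symm g).2, fun g x => ?_⟩
  have : g = FiniteField.frobeniusAlgEquivOfAlgebraic F K ^ (e.symm g).1 :=
    (e.apply_symm_apply g).symm
  conv_lhs => rw [this]
  rw [AlgEquiv.coe_pow, FiniteField.coe_frobeniusAlgEquivOfAlgebraic_iterate,
    Nat.card_eq_fintype_card]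

/-- The Dickson matrix of the `q`-polynomial `∑ g, c g * g X`. -/
def dicksonMatrix {F K : Type*} [Field F] [Field K] [Algebra F K] (c : (K ≃ₐ[F] K) → K) :
    Matrix (K ≃ₐ[F] K) (K ≃ₐ[F] K) K :=
  Matrix.of fun g h => g (c (g⁻¹ * h))

section

variable {F K : Type*} [Field F] [Finite F] [Field K] [Algebra F K]
  [FiniteDimensional F K] [DecidableEq (K ≃ₐ[F] K)]

/-- The conjugates of the eigenvalue equation say that the nonzero vector (g y) is in the kernel. -/
theorem det_dicksonMatrix_add_diagonal_eq_zero (c : (K ≃ₐ[F] K) → K) (m y : K) (hy : y ≠ 0)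
    (h : ∑ g, c g * g y = m * y) :
    (dicksonMatrix c + diagonal fun g : K ≃ₐ[F] K => -(g m)).det = 0 := by
  rw [← Matrix.exists_mulVec_eq_zero_iff]
  refine ⟨fun g => g y, fun h0 => hy (by simpa using congrFun h0 1), ?_⟩
  ext g
  rw [add_mulVec, Pi.add_apply, mulVec_diagonal, Pi.zero_apply]
  have h2 := congrArg g h
  rw [map_sum, map_mul] at h2
  have h3 : (dicksonMatrix c).mulVec (fun g => g y) g = ∑ k, g (c k * k y) := by
    rw [mulVec, dotProduct, ← Equiv.sum_comp (Equiv.mulLeft g)]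
    refine Finset.sum_congr rfl fun k _ => ?_
    simp [dicksonMatrix]
  rw [h3, h2]
  ring

/-- If `x ↦ ∑ g, c g * g x` has all `(q - 1)`-th powers among its eigenvalues, then all proper
principal minors of its Dickson matrix vanish. -/
theorem det_piecewise_dicksonMatrix_eq_zero (c : (K ≃ₐ[F] K) → K)
    (h : ∀ x : K, x ≠ 0 → ∃ y : K, y ≠ 0 ∧ ∑ g, c g * g y = x ^ (Nat.card F - 1) * y)
    (s : Finset (K ≃ₐ[F] K)) (hs : s.Nonempty) (hs' : s ≠ univ) :
    det (Matrix.of (s.piecewise (dicksonMatrix c) (1 : Matrix _ _ K))) = 0 := by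
  have : Finite K := Module.finite_of_finite F
  have := Fintype.ofFinite K
  classical
  obtain ⟨n, hn, hnt, hpow⟩ := exists_galois_exponent F K
  have hq : 2 ≤ Nat.card F := Finite.one_lt_card
  have hcard : Fintype.card K = Nat.card F ^ Module.finrank F K := by
    rw [← Nat.card_eq_fintype_card, Module.natCard_eq_pow_finrank (K := F)]
  set q := Nat.card F with hqdef
  set t := Module.finrank F K with ht
  -- The base-q digits of `e u` are 0 or 1, so `e` is injective.
  let e : Finset (K ≃ₐ[F] K) → ℕ := fun u => ∑ g ∈ u, q ^ n g
  have he : Function.Injective e := by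
    intro u v huv
    have : ∑ i ∈ u.image n, q ^ i = ∑ i ∈ v.image n, q ^ i := by
      rw [Finset.sum_image hn.injOn, Finset.sum_image hn.injOn]; exact huv
    exact Finset.image_injective hn (Finset.geomSum_injective hq this)
  have huniv : univ.image n = range t := by
    refine Finset.eq_of_subset_of_card_le (fun i hi => ?_) ?_
    · obtain ⟨g, -, rfl⟩ := mem_image.1 hi
      exact mem_range.2 (hnt g)
    · rw [card_range, card_image_of_injective _ hn, card_univ, ← Nat.card_eq_fintype_card,
        IsGalois.card_aut_eq_finrank]
  have hefull : (q - 1) * e univ = q ^ t - 1 := by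
    have : e univ = ∑ i ∈ range t, q ^ i := by rw [← huniv, Finset.sum_image hn.injOn]
    rw [this, mul_comm, Nat.geomSum_eq hq, Nat.div_mul_cancel]
    simpa using Nat.sub_dvd_pow_sub_pow q 1 t
  have helt : ∀ u, u ≠ univ → (q - 1) * e u < q ^ t - 1 := by
    intro u hu
    rw [← hefull]
    refine Nat.mul_lt_mul_of_pos_left ?_ (by omega)
    obtain ⟨g, hg⟩ : ∃ g, g ∉ u := by
      by_contra hc
      exact hu (eq_univ_iff_forall.2 fun g => by by_contra hg; exact hc ⟨g, hg⟩)
    exact Finset.sum_lt_sum_of_subset (subset_univ u) (mem_univ g) hg (by positivity)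
      fun _ _ _ => Nat.zero_le _
  -- The empty set would give the exponent q^t - 1, which is lowered to 0 because x^(q^t - 1) = 1.
  -- It then collides only with the full set, so only proper nonempty sets have their own exponent.
  let E : Finset (K ≃ₐ[F] K) → ℕ := fun u => if u = ∅ then 0 else (q - 1) * e uᶜ
  let a : Finset (K ≃ₐ[F] K) → K := fun u =>
    (∏ _g ∈ uᶜ, (-1 : K)) * det (Matrix.of (u.piecewise (dicksonMatrix c) (1 : Matrix _ _ K)))
  let p : Polynomial K := ∑ u, Polynomial.monomial (E u) (a u)
  have hElt : ∀ u, E u < q ^ t - 1 := by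
    intro u
    by_cases hu : u = ∅
    · have h1 : 2 ^ t ≤ q ^ t := Nat.pow_le_pow_left hq t
      have h2 : 2 ≤ 2 ^ t := Nat.le_self_pow (Module.finrank_pos (R := F) (M := K)).ne' 2
      simp only [E, hu, if_true]
      omega
    · simp only [E, hu, if_false]
      exact helt _ (by simpa using hu)
  have heval : ∀ x : K, x ≠ 0 → p.eval x = 0 := by
    intro x hx
    obtain ⟨y, hy, hxy⟩ := h x hx
    have hdet := det_dicksonMatrix_add_diagonal_eq_zero c _ y hy hxy
    rw [det_add_diagonal_eq_sum] at hdet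
    rw [← hdet, Polynomial.eval_finsetSum]
    refine Finset.sum_congr rfl fun u _ => ?_
    have hprod : ∏ g ∈ uᶜ, -(g (x ^ (q - 1))) = (∏ _g ∈ uᶜ, (-1 : K)) * x ^ E u := by
      have h1 : x ^ E u = x ^ ((q - 1) * e uᶜ) := by
        by_cases hu : u = ∅
        · simp only [E, hu, if_true, compl_empty, hefull, pow_zero]
          rw [← hcard, FiniteField.pow_card_sub_one_eq_one x hx]
        · simp only [E, hu, if_false]
      rw [h1, pow_mul, ← Finset.prod_pow_eq_pow_sum, ← Finset.prod_mul_distrib]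
      refine Finset.prod_congr rfl fun g _ => ?_
      rw [hpow]; ring
    rw [Polynomial.eval_monomial, hprod]
    ring
  -- All q^t - 1 nonzero elements of K are roots, more than the degree allows.
  have hp : p = 0 := by
    refine Polynomial.eq_zero_of_natDegree_lt_card_of_eval_eq_zero' p (univ.erase 0)
      (fun x hx => heval x (ne_of_mem_erase hx)) ?_
    rw [card_erase_of_mem (mem_univ _), card_univ, hcard]
    refine lt_of_le_of_lt (Polynomial.natDegree_sum_le_of_forall_le (n := q ^ t - 2) _ _ fun u _ =>
      (Polynomial.natDegree_monomial_le _).trans ?_) ?_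
    · have := hElt u; omega
    · have := hElt s; omega
  have hcoeff := congrArg (Polynomial.coeff · (E s)) hp
  simp only [p, Polynomial.finsetSum_coeff, Polynomial.coeff_monomial, Polynomial.coeff_zero]
    at hcoeff
  rw [Finset.sum_eq_single s] at hcoeff
  · simpa [a] using hcoeff
  · intro u _ hu
    rw [if_neg]
    intro hE
    have hEs : E s = (q - 1) * e sᶜ := by simp only [E, hs.ne_empty, if_false]
    by_cases hu0 : u = ∅
    · obtain ⟨g, hg⟩ : ∃ g, g ∈ sᶜ := by
        by_contra hc
        exact hs' (by simpa using Finset.not_nonempty_iff_eq_empty.1 hc)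
      have : 0 < e sᶜ := Finset.sum_pos (fun g _ => by positivity) ⟨g, hg⟩
      have h2 : 0 < (q - 1) * e sᶜ := Nat.mul_pos (by omega) this
      rw [hEs] at hE
      simp only [E, hu0, if_true] at hE
      omega
    · rw [hEs] at hE
      simp only [E, hu0, if_false] at hE
      exact hu (compl_injective (he (Nat.eq_of_mul_eq_mul_left (by omega) hE)))
  · simp

/-- Since the proper principal minors vanish, every proper nonempty index set contains a row that is
zero on that set. The complement of 1 isolates one coefficient; the subgroup generated by its index
shows that this index is a generator. -/
theorem exists_generator_of_powers_eigenvalues (c : (K ≃ₐ[F] K) → K) (ht : 2 ≤ Module.finrank F K)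
    (h : ∀ x : K, x ≠ 0 → ∃ y : K, y ≠ 0 ∧ ∑ g, c g * g y = x ^ (Nat.card F - 1) * y) :
    ∃ τ : K ≃ₐ[F] K, Subgroup.zpowers τ = ⊤ ∧ c τ ≠ 0 ∧ ∀ g, g ≠ τ → c g = 0 := by
  have : Finite K := Module.finite_of_finite F
  have hclosed : ∀ s : Finset (K ≃ₐ[F] K), s.Nonempty → s ≠ univ →
      ∃ i ∈ s, ∀ j ∈ s, dicksonMatrix c i j = 0 := by
    intro s hs hs'
    by_contra! hc
    obtain ⟨u, hus, hu, hdet⟩ := exists_det_piecewise_ne_zero _ s hs hc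
    refine hdet (det_piecewise_dicksonMatrix_eq_zero c h u hu ?_)
    rintro rfl
    exact hs' (univ_subset_iff.1 hus)
  have hcard : Fintype.card (K ≃ₐ[F] K) = Module.finrank F K := by
    rw [← Nat.card_eq_fintype_card, IsGalois.card_aut_eq_finrank]
  have : Nontrivial (K ≃ₐ[F] K) := Fintype.one_lt_card_iff_nontrivial.1 (by omega)
  obtain ⟨g, hg⟩ := exists_ne (1 : K ≃ₐ[F] K)
  -- Row i of the Dickson matrix is zero outside column 1, which carries the coefficient of index
  -- `i⁻¹`.
  obtain ⟨i, -, hi⟩ := hclosed (univ.erase 1) ⟨g, by simpa using hg⟩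
    (fun hu => by simpa using hu.ge (mem_univ (1 : K ≃ₐ[F] K)))
  have hzero : ∀ g, g ≠ i⁻¹ → c g = 0 := by
    intro g hg
    have h1 := hi (i * g) (by simpa [mul_eq_one_iff_eq_inv'] using hg)
    simpa [dicksonMatrix] using h1
  have hne : c i⁻¹ ≠ 0 := by
    intro h0
    obtain ⟨y, hy, hy2⟩ := h 1 one_ne_zero
    rw [Finset.sum_eq_zero] at hy2
    · simp [eq_comm, hy] at hy2
    · intro g _
      by_cases hg : g = i⁻¹
      · rw [hg, h0, zero_mul]
      · rw [hzero g hg, zero_mul]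
  refine ⟨i⁻¹, ?_, hne, hzero⟩
  by_contra htop
  classical
  obtain ⟨k, hk, hk2⟩ := hclosed (univ.filter (· ∈ Subgroup.zpowers i⁻¹))
    ⟨1, by simp⟩
    (fun hu => htop ((Subgroup.eq_top_iff' _).2 fun g => by simpa using hu.ge (mem_univ g)))
  -- If the subgroup were proper, some row k in it would vanish on it; but its entry in column `k *
  -- i⁻¹` is a conjugate of the nonzero coefficient.
  have h1 := hk2 (k * i⁻¹) (by
    simp only [mem_filter, mem_univ, true_and] at hk ⊢
    exact mul_mem hk (Subgroup.mem_zpowers _))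
  simp [dicksonMatrix, hne] at h1

end

end PseudoReg

/-! ### Galois conjugation and the pointwise stabilizer of the subgeometry. -/

namespace PseudoReg

open Module

section GaloisConjugation

variable {F K V ι : Type*} [Field F] [Field K] [Algebra F K] [AddCommGroup V] [Module K V]
  [Module F V] [IsScalarTower F K V] [Fintype ι]

/-- The action of `Gal(K/F)` on the coordinates with respect to a `K`-basis. -/
noncomputable def galConj (B : Basis ι K V) : (K ≃ₐ[F] K) →* (V ≃ₗ[F] V) where
  toFun g := (B.equivFun.restrictScalars F).trans
    ((LinearEquiv.piCongrRight fun _ => g.toLinearEquiv).trans (B.equivFun.restrictScalars F).symm)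
  map_one' := LinearEquiv.ext fun v => B.equivFun.symm_apply_apply v
  map_mul' g h := by
    ext v
    change B.equivFun.symm (fun i => g (h (B.equivFun v i))) =
      B.equivFun.symm (fun i => g (B.equivFun (B.equivFun.symm fun i => h (B.equivFun v i)) i))
    rw [LinearEquiv.apply_symm_apply]

@[simp]
theorem repr_galConj (B : Basis ι K V) (g : K ≃ₐ[F] K) (v : V) (i : ι) :
    B.repr (galConj B g v) i = g (B.repr v i) := by
  change B.equivFun (B.equivFun.symm fun i => g (B.equivFun v i)) i = _
  rw [LinearEquiv.apply_symm_apply]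
  rfl

theorem galConj_smul (B : Basis ι K V) (g : K ≃ₐ[F] K) (a : K) (v : V) :
    galConj B g (a • v) = g a • galConj B g v := by
  apply B.ext_elem
  simp

theorem galConj_mul_apply (B : Basis ι K V) (g h : K ≃ₐ[F] K) (v : V) :
    galConj B (g * h) v = galConj B g (galConj B h v) := by
  rw [map_mul]; rfl

theorem galConj_one_apply (B : Basis ι K V) (v : V) :
    galConj B (1 : K ≃ₐ[F] K) v = v := by
  rw [map_one]; rfl

theorem galConj_apply_basis (B : Basis ι K V) (g : K ≃ₐ[F] K) (i : ι) :
    galConj B g (B i) = B i := by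
  classical
  apply B.ext_elem
  intro j
  rw [repr_galConj, B.repr_self, Finsupp.single_apply]
  split_ifs <;> simp

theorem galConj_apply_of_mem (B : Basis ι K V) (g : K ≃ₐ[F] K) {w : V}
    (hw : w ∈ Submodule.span F (Set.range B)) : galConj B g w = w := by
  induction hw using Submodule.span_induction with
  | mem x hx => obtain ⟨i, rfl⟩ := hx; exact galConj_apply_basis B g i
  | zero => exact map_zero _
  | add x y _ _ hx hy => rw [map_add, hx, hy]
  | smul a x _ hx => rw [map_smul, hx]

theorem galConj_ne_zero (B : Basis ι K V) (g : K ≃ₐ[F] K) {v : V} (hv : v ≠ 0) :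
    galConj B g v ≠ 0 :=
  (galConj B g).map_ne_zero_iff.2 hv

section Descent

variable [FiniteDimensional F K] [IsGalois F K]

theorem mem_span_of_galConj_eq (B : Basis ι K V) {v : V}
    (hv : ∀ g : K ≃ₐ[F] K, galConj B g v = v) : v ∈ Submodule.span F (Set.range B) := by
  have hc : ∀ i, ∃ a : F, algebraMap F K a = B.repr v i := by
    intro i
    refine IntermediateField.mem_bot.1 ((IsGalois.mem_bot_iff_fixed _).2 fun g => ?_)
    rw [← repr_galConj, hv]
  choose a ha using hc
  rw [← B.sum_repr v]
  refine Submodule.sum_mem _ fun i _ => ?_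
  rw [← ha, algebraMap_smul]
  exact Submodule.smul_mem _ _ (Submodule.subset_span ⟨i, rfl⟩)

/-- A nonzero subspace stable under Galois conjugation contains a nonzero rational vector. -/
theorem exists_mem_span_of_galConj_stable (B : Basis ι K V) (N : Submodule K V) (hN : N ≠ ⊥)
    (hstable : ∀ (g : K ≃ₐ[F] K), ∀ v ∈ N, galConj B g v ∈ N) :
    ∃ w ∈ Submodule.span F (Set.range B), w ≠ 0 ∧ w ∈ N := by
  obtain ⟨u, huN, hu⟩ := N.exists_mem_ne_zero_of_ne_bot hN
  obtain ⟨i, hi⟩ : ∃ i, B.repr u i ≠ 0 := by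
    by_contra! hc
    exact hu (B.ext_elem fun i => by simp [hc])
  obtain ⟨a, ha⟩ := Algebra.trace_surjective F K 1
  -- The i-th coordinate of `x` has trace 1, so the sum of the conjugates of `x` is not zero.
  let x := (a * (B.repr u i)⁻¹) • u
  refine ⟨∑ g : K ≃ₐ[F] K, galConj B g x, mem_span_of_galConj_eq B fun h => ?_, fun h0 => ?_, ?_⟩
  · rw [map_sum, ← Equiv.sum_comp (Equiv.mulLeft h) fun g => galConj B g x]
    exact Finset.sum_congr rfl fun g _ => (galConj_mul_apply B h g x).symm
  · have h1 : B.repr (∑ g : K ≃ₐ[F] K, galConj B g x) i = 1 := by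
      rw [map_sum, Finsupp.finsetSum_apply]
      simp only [repr_galConj]
      rw [← trace_eq_sum_automorphisms]
      simp [x, hi, ha]
    rw [h0] at h1
    simp at h1
  · exact Submodule.sum_mem _ fun g _ => hstable g x (N.smul_mem _ huN)

end Descent

/-- Galois conjugation as a semilinear map. -/
noncomputable def galSemilinear (B : Basis ι K V) (g : K ≃ₐ[F] K) :
    V →ₛₗ[(g : K →+* K)] V where
  toFun := galConj B g
  map_add' := map_add _
  map_smul' := galConj_smul B g

/-- The permutation of the points of `PG_K(V)` induced by Galois conjugation. -/
noncomputable def galPerm (B : Basis ι K V) : (K ≃ₐ[F] K) →* Equiv.Perm (Projectivization K V) :=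
  MonoidHom.toHomPerm
    { toFun g := Projectivization.map (galSemilinear B g) (galConj B g).injective
      map_one' := by
        funext P
        induction P using Projectivization.ind with
        | h v hv =>
          change Projectivization.mk K (galConj B 1 v) _ = Projectivization.mk K v hv
          simp only [galConj_one_apply]
      map_mul' g h := by
        funext P
        induction P using Projectivization.ind with
        | h v hv =>
          change Projectivization.mk K (galConj B (g * h) v) _ =
            Projectivization.mk K (galConj B g (galConj B h v)) _
          simp only [galConj_mul_apply] }

theorem galPerm_mk (B : Basis ι K V) (g : K ≃ₐ[F] K) (v : V) (hv : v ≠ 0) :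
    galPerm B g (Projectivization.mk K v hv) =
      Projectivization.mk K (galConj B g v) (galConj_ne_zero B g hv) := rfl

theorem galPerm_injective [Nontrivial ι] (B : Basis ι K V) :
    Function.Injective (galPerm B : (K ≃ₐ[F] K) →* _) := by
  classical
  rw [injective_iff_map_eq_one]
  intro g hg
  ext a
  obtain ⟨i, j, hij⟩ := exists_pair_ne ι
  have hv : B i + a • B j ≠ 0 := by
    intro h0
    have := congrArg (fun v => B.repr v i) h0
    simp [hij.symm] at this
  have h1 := Equiv.ext_iff.1 hg (Projectivization.mk K _ hv)
  rw [galPerm_mk, Equiv.Perm.one_apply, Projectivization.mk_eq_mk_iff'] at h1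
  obtain ⟨c, hc⟩ := h1
  have hi := congrArg (fun v => B.repr v i) hc
  have hj := congrArg (fun v => B.repr v j) hc
  simp [hij, hij.symm] at hi hj
  simp [← hj, hi]

/-- The group of collineations fixing a canonical subgeometry pointwise is the Galois group. -/
theorem pointwiseStabilizer_eq_range [Nontrivial ι] (B : Basis ι K V) :
    pointwiseStabilizer (linearPoints K (Submodule.span F (Set.range B))) =
      (galPerm B : (K ≃ₐ[F] K) →* _).range := by
  classical
  apply le_antisymm
  · rintro s ⟨⟨σ, f, hf, hs⟩, hfix⟩
    have hfix' : ∀ w ∈ Submodule.span F (Set.range B), w ≠ 0 → ∃ c : K, c • w = f w := by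
      intro w hw hw0
      have h1 := (mem_fixingSubgroup_iff _).1 hfix (Projectivization.mk K w hw0) ⟨w, hw0, hw, rfl⟩
      rw [Equiv.Perm.smul_def, hs, Projectivization.mk_eq_mk_iff'] at h1
      exact h1
    have hB : ∀ i, B i ∈ Submodule.span F (Set.range B) := fun i =>
      Submodule.subset_span ⟨i, rfl⟩
    choose c hc using fun i => hfix' (B i) (hB i) (B.ne_zero i)
    have hc0 : ∀ i, c i ≠ 0 := by
      intro i h0
      have := hc i
      rw [h0, zero_smul, eq_comm, f.map_eq_zero_iff] at this
      exact B.ne_zero i this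
    -- Compare coordinates in the image of the fixed point ⟨B i + a B j⟩. For a = 1 this makes all
    -- `c i` equal; then σ fixes F.
    have key : ∀ i j, i ≠ j → ∀ a : F, c i * algebraMap F K a = σ (algebraMap F K a) * c j := by
      intro i j hij a
      have hv : B i + a • B j ≠ 0 := by
        intro h0
        have := congrArg (fun v => B.repr v i) h0
        rw [← algebraMap_smul K a] at this
        simp [hij.symm, -algebraMap_smul] at this
      obtain ⟨d, hd⟩ := hfix' _ (add_mem (hB i) (Submodule.smul_mem _ a (hB j))) hv
      rw [← algebraMap_smul K a, map_add, hf, ← hc, ← hc] at hd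
      have hi := congrArg (fun v => B.repr v i) hd
      have hj := congrArg (fun v => B.repr v j) hd
      simp [hij, hij.symm, -algebraMap_smul] at hi hj
      rw [← hi, hj]
    have hcc : ∀ i j, c i = c j := by
      intro i j
      by_cases hij : i = j
      · rw [hij]
      · simpa using key i j hij 1
    obtain ⟨i, j, hij⟩ := exists_pair_ne ι
    let g : K ≃ₐ[F] K := AlgEquiv.ofRingEquiv (f := σ) (fun a => by
      have := key i j hij a
      rw [hcc i j, mul_comm] at this
      exact (mul_right_cancel₀ (hc0 j) this).symm)
    have hfg : ∀ v, f v = c i • galConj B g v := by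
      intro v
      conv_lhs => rw [← B.sum_repr v]
      conv_rhs => rw [← B.sum_repr v]
      rw [map_sum, map_sum, Finset.smul_sum]
      refine Finset.sum_congr rfl fun k _ => ?_
      rw [hf, galConj_smul, galConj_apply_basis, ← hc, hcc k i, smul_comm]
      rfl
    refine ⟨g, ?_⟩
    ext P
    induction P using Projectivization.ind with
    | h v hv =>
      rw [galPerm_mk, hs, eq_comm, Projectivization.mk_eq_mk_iff']
      exact ⟨c i, (hfg v).symm⟩
  · rintro _ ⟨g, rfl⟩
    refine ⟨⟨g.toRingEquiv, (galConj B g).toAddEquiv, galConj_smul B g, galPerm_mk B g⟩, ?_⟩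
    refine (mem_fixingSubgroup_iff _).2 ?_
    rintro _ ⟨w, hw0, hw, rfl⟩
    rw [Equiv.Perm.smul_def, galPerm_mk]
    simp only [galConj_apply_of_mem B g hw]

theorem isStabilizerGenerator_iff [Nontrivial ι] (B : Basis ι K V)
    (s : Equiv.Perm (Projectivization K V)) :
    IsStabilizerGenerator (linearPoints K (Submodule.span F (Set.range B))) s ↔
      ∃ σ : K ≃ₐ[F] K, Subgroup.zpowers σ = ⊤ ∧ s = galPerm B σ := by
  rw [IsStabilizerGenerator, pointwiseStabilizer_eq_range, MonoidHom.range_eq_map]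
  constructor
  · intro h
    obtain ⟨σ, -, rfl⟩ : s ∈ (⊤ : Subgroup (K ≃ₐ[F] K)).map (galPerm B) :=
      h ▸ Subgroup.mem_zpowers s
    rw [← MonoidHom.map_zpowers] at h
    exact ⟨σ, Subgroup.map_injective (galPerm_injective B) h, rfl⟩
  · rintro ⟨σ, h, rfl⟩
    rw [← MonoidHom.map_zpowers, h]

end GaloisConjugation

end PseudoReg

/-! ### Galois bases and the centers they define. -/

namespace PseudoReg

open Module

section SpanPoints

variable {K V : Type*} [Field K] [AddCommGroup V] [Module K V]

theorem spanPoints_le {T : Set (Projectivization K V)} {N : Submodule K V} :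
    spanPoints T ≤ N ↔ ∀ P ∈ T, P.submodule ≤ N := by
  simp [spanPoints]

theorem submodule_mk_le_iff {v : V} (hv : v ≠ 0) {N : Submodule K V} :
    (Projectivization.mk K v hv).submodule ≤ N ↔ v ∈ N := by
  rw [Projectivization.submodule_mk, Submodule.span_singleton_le_iff_mem]

theorem mem_spanPoints_of_mk_mem {T : Set (Projectivization K V)} {v : V} (hv : v ≠ 0)
    (h : Projectivization.mk K v hv ∈ T) : v ∈ spanPoints T :=
  (submodule_mk_le_iff hv).1 (spanPoints_le.1 le_rfl _ h)

theorem spanPoints_linearPoints {F : Type*} [Field F] [Module F V] (U : Submodule F V) :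
    spanPoints (linearPoints K U) = Submodule.span K (U : Set V) := by
  apply le_antisymm
  · rw [spanPoints_le]
    rintro _ ⟨u, hu0, hu, rfl⟩
    rw [submodule_mk_le_iff]
    exact Submodule.subset_span hu
  · rw [Submodule.span_le]
    intro u hu
    by_cases hu0 : u = 0
    · rw [hu0]; exact zero_mem _
    · exact mem_spanPoints_of_mk_mem hu0 ⟨u, hu0, hu, rfl⟩

theorem finrank_span_le_finrank {F : Type*} [Field F] [Algebra F K] [Module F V]
    [IsScalarTower F K V] (U : Submodule F V) [FiniteDimensional F U] :
    finrank K (Submodule.span K (U : Set V)) ≤ finrank F U := by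
  let b := finBasis F U
  have h : Submodule.span K (U : Set V) ≤ Submodule.span K (Set.range fun i => (b i : V)) := by
    rw [Submodule.span_le]
    intro u hu
    have h1 := congrArg U.subtype (b.sum_repr ⟨u, hu⟩)
    rw [map_sum] at h1
    change _ = u at h1
    rw [← h1]
    refine Submodule.sum_mem _ fun i _ => ?_
    rw [map_smul, ← algebraMap_smul K]
    exact Submodule.smul_mem _ _ (Submodule.subset_span ⟨i, rfl⟩)
  have := FiniteDimensional.span_of_finite K (Set.finite_range fun i => (b i : V))
  exact (Submodule.finrank_mono h).trans ((finrank_range_le_card _).trans (by simp))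

end SpanPoints

section GaloisBasis

variable {F K V ι : Type*} [Field F] [Field K] [Algebra F K] [AddCommGroup V] [Module K V]
  [Module F V] [IsScalarTower F K V] [Fintype ι]

/-- A `K`-basis indexed by `Gal(K/F)` which is permuted regularly by Galois conjugation. -/
def IsGaloisBasis (B : Basis ι K V) (E : Basis (K ≃ₐ[F] K) K V) : Prop :=
  ∀ h g, galConj B h (E g) = E (h * g)

/-- The subspace where the coordinates of index `1` and `σ` vanish. -/
noncomputable def galoisCenter (E : Basis (K ≃ₐ[F] K) K V) (σ : K ≃ₐ[F] K) : Submodule K V :=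
  LinearMap.ker (E.coord 1) ⊓ LinearMap.ker (E.coord σ)

@[simp]
theorem mem_galoisCenter {E : Basis (K ≃ₐ[F] K) K V} {σ : K ≃ₐ[F] K} {u : V} :
    u ∈ galoisCenter E σ ↔ E.repr u 1 = 0 ∧ E.repr u σ = 0 := Iff.rfl

variable [FiniteDimensional F K] {B : Basis ι K V} {E : Basis (K ≃ₐ[F] K) K V}

theorem IsGaloisBasis.repr_galConj_mul (hE : IsGaloisBasis B E) (h g : K ≃ₐ[F] K) (u : V) :
    E.repr (galConj B h u) (h * g) = h (E.repr u g) := by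
  classical
  conv_lhs => rw [← E.sum_repr u]
  rw [map_sum, map_sum, Finsupp.finsetSum_apply, Finset.sum_eq_single g]
  · rw [galConj_smul, hE]; simp
  · intro k _ hk
    rw [galConj_smul, hE]; simp [hk]
  · simp

theorem IsGaloisBasis.repr_galConj (hE : IsGaloisBasis B E) (h g : K ≃ₐ[F] K) (u : V) :
    E.repr (galConj B h u) g = h (E.repr u (h⁻¹ * g)) := by
  rw [← hE.repr_galConj_mul, mul_inv_cancel_left]

theorem IsGaloisBasis.repr_of_mem (hE : IsGaloisBasis B E) {w : V}
    (hw : w ∈ Submodule.span F (Set.range B)) (g : K ≃ₐ[F] K) :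
    E.repr w g = g (E.repr w 1) := by
  conv_lhs => rw [← galConj_apply_of_mem B g hw]
  rw [hE.repr_galConj, inv_mul_cancel]

theorem IsGaloisBasis.eq_zero_of_mem (hE : IsGaloisBasis B E) {w : V}
    (hw : w ∈ Submodule.span F (Set.range B)) (h : E.repr w 1 = 0) : w = 0 := by
  refine E.ext_elem fun g => ?_
  rw [hE.repr_of_mem hw, h]
  simp

/-- A subspace stable under Galois conjugation which contains a vector of a Galois basis is the
whole space. -/
theorem IsGaloisBasis.eq_top_of_stable (hE : IsGaloisBasis B E) {N : Submodule K V}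
    (hstable : ∀ (g : K ≃ₐ[F] K), ∀ v ∈ N, galConj B g v ∈ N) {g : K ≃ₐ[F] K} (hg : E g ∈ N) :
    N = ⊤ := by
  rw [eq_top_iff, ← E.span_eq, Submodule.span_le]
  rintro _ ⟨h, rfl⟩
  have := hstable (h * g⁻¹) _ hg
  rwa [hE, inv_mul_cancel_right] at this

/-- The conjugates of `a` are t functionals whose common kernel is Galois stable. If it were nonzero
it would contain a nonzero rational vector, which `a` does not kill. So they are the coordinates of
a basis. -/
theorem exists_galoisBasis_of_functional [IsGalois F K] (B : Basis ι K V)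
    (hdim : finrank K V = finrank F K) (a : V →ₗ[K] K)
    (ha : ∀ w ∈ Submodule.span F (Set.range B), a w = 0 → w = 0) :
    ∃ E : Basis (K ≃ₐ[F] K) K V, IsGaloisBasis B E ∧
      ∀ u g, E.repr u g = g (a (galConj B g⁻¹ u)) := by
  classical
  have := B.finiteDimensional_of_finite
  let φ : V →ₗ[K] (K ≃ₐ[F] K) → K :=
    { toFun u g := g (a (galConj B g⁻¹ u))
      map_add' u v := by ext; simp
      map_smul' c u := by
        ext g
        have : g (g⁻¹ c) = c := by rw [← AlgEquiv.mul_apply, mul_inv_cancel]; rfl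
        change g (a (galConj B g⁻¹ (c • u))) = c * g (a (galConj B g⁻¹ u))
        rw [galConj_smul, map_smul, smul_eq_mul, map_mul, this] }
  have hφ : Function.Injective φ := by
    rw [← LinearMap.ker_eq_bot]
    by_contra hne
    obtain ⟨w, hw, hw0, hwφ⟩ := exists_mem_span_of_galConj_stable (F := F) B _ hne (by
      intro h v hv
      rw [LinearMap.mem_ker] at hv ⊢
      ext g
      have h1 := congrFun hv (h⁻¹ * g)
      change (h⁻¹ * g) (a (galConj B (h⁻¹ * g)⁻¹ v)) = 0 at h1
      change g (a (galConj B g⁻¹ (galConj B h v))) = 0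
      rw [← galConj_mul_apply]
      rw [mul_inv_rev, inv_inv] at h1
      simpa using h1)
    have h1 : (1 : K ≃ₐ[F] K) (a (galConj B (1 : K ≃ₐ[F] K)⁻¹ w)) = 0 := congrFun hwφ 1
    rw [inv_one, galConj_one_apply] at h1
    exact hw0 (ha w hw h1)
  have hrank : finrank K V = finrank K ((K ≃ₐ[F] K) → K) := by
    rw [finrank_fintype_fun_eq_card, ← Nat.card_eq_fintype_card, IsGalois.card_aut_eq_finrank, hdim]
  let E := Basis.ofEquivFun (LinearEquiv.ofInjectiveOfFinrankEq φ hφ hrank)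
  have hrepr : ∀ u g, E.repr u g = g (a (galConj B g⁻¹ u)) := fun u g => rfl
  refine ⟨E, fun h g => E.ext_elem fun k => ?_, hrepr⟩
  have h1 : E.repr (galConj B h (E g)) k = h (E.repr (E g) (h⁻¹ * k)) := by
    rw [hrepr, hrepr, ← galConj_mul_apply, mul_inv_rev, inv_inv, ← AlgEquiv.mul_apply,
      mul_inv_cancel_left]
  rw [h1, E.repr_self, E.repr_self, Finsupp.single_apply, Finsupp.single_apply]
  by_cases hk : h * g = k
  · rw [if_pos hk, if_pos (by rw [← hk, inv_mul_cancel_left]), map_one]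
  · rw [if_neg hk, if_neg (fun h2 => hk (by rw [h2, mul_inv_cancel_left])), map_zero]

theorem exists_galoisBasis_of_vector [IsGalois F K] (B : Basis ι K V)
    (hdim : finrank K V = finrank F K) (v : V) (h : K ≃ₐ[F] K)
    (hv : ⊤ ≤ Submodule.span K (Set.range fun g : K ≃ₐ[F] K => galConj B g v)) :
    ∃ E : Basis (K ≃ₐ[F] K) K V, IsGaloisBasis B E ∧ E h = v := by
  have hcard : Fintype.card (K ≃ₐ[F] K) = finrank K V := by
    rw [← Nat.card_eq_fintype_card, IsGalois.card_aut_eq_finrank, hdim]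
  let E := basisOfTopLeSpanOfCardEqFinrank (fun g : K ≃ₐ[F] K => galConj B (g * h⁻¹) v)
    (by
      refine hv.trans (Submodule.span_mono ?_)
      rintro _ ⟨g, rfl⟩
      exact ⟨g * h, by simp⟩) hcard
  have hE : ∀ g, E g = galConj B (g * h⁻¹) v := fun g => by
    simp [E]
  refine ⟨E, fun k g => ?_, ?_⟩
  · rw [hE, hE, ← galConj_mul_apply, mul_assoc]
  · rw [hE, mul_inv_cancel, galConj_one_apply]

theorem orbitSpan_galPerm (B : Basis ι K V) (σ : K ≃ₐ[F] K) (v : V) (hv : v ≠ 0) (n : ℕ) :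
    orbitSpan (galPerm B σ) (Projectivization.mk K v hv) n =
      Submodule.span K {u | ∃ i < n, u = galConj B (σ ^ i) v} := by
  apply le_antisymm
  · rw [orbitSpan, spanPoints_le]
    rintro _ ⟨i, hi, rfl⟩
    rw [← map_pow, galPerm_mk, submodule_mk_le_iff]
    exact Submodule.subset_span ⟨i, hi, rfl⟩
  · rw [Submodule.span_le]
    rintro _ ⟨i, hi, rfl⟩
    refine mem_spanPoints_of_mk_mem (galConj_ne_zero B _ hv) ⟨i, hi, ?_⟩
    rw [← map_pow, galPerm_mk]

theorem mem_imageSubspace_galPerm (B : Basis ι K V) (σ : K ≃ₐ[F] K) (N : Submodule K V) (x : V) :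
    x ∈ imageSubspace (galPerm B σ) N ↔ galConj B σ⁻¹ x ∈ N := by
  have hcancel : ∀ v, galConj B σ⁻¹ (galConj B σ v) = v := fun v => by
    rw [← galConj_mul_apply, inv_mul_cancel, galConj_one_apply]
  have hcancel' : ∀ v, galConj B σ (galConj B σ⁻¹ v) = v := fun v => by
    rw [← galConj_mul_apply, mul_inv_cancel, galConj_one_apply]
  constructor
  · let N' : Submodule K V := N.comap (galSemilinear B σ⁻¹)
    have h : imageSubspace (galPerm B σ) N ≤ N' := by
      rw [imageSubspace, spanPoints_le]
      rintro _ ⟨P, hP, rfl⟩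
      induction P using Projectivization.ind with
      | h v hv =>
        rw [galPerm_mk, submodule_mk_le_iff]
        change galConj B σ⁻¹ (galConj B σ v) ∈ N
        rw [hcancel]
        exact (submodule_mk_le_iff hv).1 hP
    exact fun hx => h hx
  · intro hx
    by_cases hx0 : x = 0
    · rw [hx0]; exact zero_mem _
    · refine mem_spanPoints_of_mk_mem hx0 ⟨Projectivization.mk K _ (galConj_ne_zero B σ⁻¹ hx0),
        (submodule_mk_le_iff _).2 hx, ?_⟩
      rw [galPerm_mk]
      simp only [hcancel']

theorem galConj_mem_span_linearPoints (B : Basis ι K V) {U : Submodule F V}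
    (hU : linearPoints K U ⊆ linearPoints K (Submodule.span F (Set.range B)))
    (g : K ≃ₐ[F] K) {v : V} (hv : v ∈ spanPoints (linearPoints K U)) :
    galConj B g v ∈ spanPoints (linearPoints K U) := by
  let N' : Submodule K V := (spanPoints (linearPoints K U)).comap (galSemilinear B g)
  suffices h : spanPoints (linearPoints K U) ≤ N' from h hv
  rw [spanPoints_le]
  intro P hP
  obtain ⟨w, hw0, hw, rfl⟩ := hU hP
  rw [submodule_mk_le_iff]
  change galConj B g w ∈ spanPoints (linearPoints K U)
  rw [galConj_apply_of_mem B g hw]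
  exact mem_spanPoints_of_mk_mem hw0 hP

end GaloisBasis

section Center

variable {F K V ι : Type*} [Field F] [Field K] [Algebra F K] [AddCommGroup V] [Module K V]
  [Module F V] [IsScalarTower F K V] [Fintype ι] [FiniteDimensional F K]
  {B : Basis ι K V} {E : Basis (K ≃ₐ[F] K) K V} {σ : K ≃ₐ[F] K}

theorem orderOf_eq_finrank_of_zpowers_eq_top [IsGalois F K] (hσ : Subgroup.zpowers σ = ⊤) :
    orderOf σ = finrank F K := by
  rw [← Nat.card_zpowers, hσ, Subgroup.card_top, IsGalois.card_aut_eq_finrank]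

theorem exists_pow_lt_of_zpowers_eq_top [IsGalois F K]
    (hσ : Subgroup.zpowers σ = ⊤) (g : K ≃ₐ[F] K) :
    ∃ i < finrank F K, σ ^ i = g := by
  classical
  have h2 : g ∈ Subgroup.zpowers σ := hσ ▸ Subgroup.mem_top g
  rw [mem_zpowers_iff_mem_range_orderOf, orderOf_eq_finrank_of_zpowers_eq_top hσ] at h2
  simpa using h2

theorem pow_ne_one_of_lt [IsGalois F K] (hσ : Subgroup.zpowers σ = ⊤) {i : ℕ} (hi : i ≠ 0)
    (hi' : i < finrank F K) : σ ^ i ≠ 1 :=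
  pow_ne_one_of_lt_orderOf hi (by rwa [orderOf_eq_finrank_of_zpowers_eq_top hσ])

theorem basis_mem_galoisCenter {g : K ≃ₐ[F] K} (h1 : g ≠ 1) (h2 : g ≠ σ) :
    E g ∈ galoisCenter E σ := by
  simp [h1, h2]

theorem sq_ne_of_generator [IsGalois F K] (ht : 3 ≤ finrank F K) (hσ : Subgroup.zpowers σ = ⊤) :
    σ ≠ 1 ∧ σ ^ 2 ≠ 1 ∧ σ ^ 2 ≠ σ := by
  have h1 : σ ≠ 1 := by simpa using pow_ne_one_of_lt hσ (i := 1) (by omega) (by omega)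
  refine ⟨h1, pow_ne_one_of_lt hσ (by omega) (by omega), fun h => h1 ?_⟩
  rwa [pow_two, mul_eq_left] at h

theorem galoisCenter_eq_span_image :
    galoisCenter E σ = Submodule.span K (E '' {g | g ≠ 1 ∧ g ≠ σ}) := by
  ext u
  rw [Basis.mem_span_image, mem_galoisCenter]
  constructor
  · rintro ⟨h1, h2⟩ g hg
    rw [Finset.mem_coe, Finsupp.mem_support_iff] at hg
    exact ⟨by rintro rfl; exact hg h1, by rintro rfl; exact hg h2⟩
  · intro h
    constructor <;> by_contra hc
    · exact (h (Finset.mem_coe.2 (Finsupp.mem_support_iff.2 hc))).1 rfl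
    · exact (h (Finset.mem_coe.2 (Finsupp.mem_support_iff.2 hc))).2 rfl

theorem IsGaloisBasis.galoisCenter_eq_orbitSpan [IsGalois F K] (hE : IsGaloisBasis B E)
    (ht : 3 ≤ finrank F K) (hσ : Subgroup.zpowers σ = ⊤) :
    galoisCenter E σ = orbitSpan (galPerm B σ)
      (Projectivization.mk K (E (σ ^ 2)) (E.ne_zero _)) (finrank F K - 2) := by
  rw [orbitSpan_galPerm, galoisCenter_eq_span_image]
  congr 1
  ext u
  simp only [Set.mem_image, Set.mem_ofPred_eq, hE _ _, ← pow_add]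
  constructor
  · rintro ⟨g, ⟨h1, h2⟩, rfl⟩
    obtain ⟨i, hi, rfl⟩ := exists_pow_lt_of_zpowers_eq_top hσ g
    have h0 : i ≠ 0 := by rintro rfl; simp at h1
    have h1 : i ≠ 1 := by rintro rfl; simp at h2
    exact ⟨i - 2, by omega, by rw [Nat.sub_add_cancel (by omega)]⟩
  · rintro ⟨i, hi, rfl⟩
    refine ⟨_, ⟨pow_ne_one_of_lt hσ (by omega) (by omega), fun h => ?_⟩, rfl⟩
    rw [show i + 2 = (i + 1) + 1 by omega, pow_succ, mul_eq_right] at h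
    exact pow_ne_one_of_lt hσ (by omega) (by omega) h

theorem IsGaloisBasis.orbitSpan_eq_top [IsGalois F K] (hE : IsGaloisBasis B E)
    (hσ : Subgroup.zpowers σ = ⊤) (g : K ≃ₐ[F] K) :
    orbitSpan (galPerm B σ) (Projectivization.mk K (E g) (E.ne_zero _)) (finrank F K) = ⊤ := by
  rw [orbitSpan_galPerm, eq_top_iff, ← E.span_eq, Submodule.span_le]
  rintro _ ⟨h, rfl⟩
  obtain ⟨i, hi, hi2⟩ := exists_pow_lt_of_zpowers_eq_top hσ (h * g⁻¹)
  refine Submodule.subset_span ⟨i, hi, ?_⟩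
  rw [hE, hi2, inv_mul_cancel_right]

/-- The image of the center is cut out by the coordinates σ and σ^2, so the intersection is cut out
by 1, σ and σ^2, which are distinct as t ≥ 3. -/
theorem IsGaloisBasis.finrank_inf_imageSubspace [IsGalois F K] (hE : IsGaloisBasis B E)
    (ht : 3 ≤ finrank F K) (hσ : Subgroup.zpowers σ = ⊤) :
    finrank K (galoisCenter E σ ⊓ imageSubspace (galPerm B σ) (galoisCenter E σ) :
      Submodule K V) = finrank F K - 3 := by
  classical
  obtain ⟨h1, h2, h3⟩ := sq_ne_of_generator ht hσ
  let s : Finset (K ≃ₐ[F] K) := {1, σ, σ ^ 2}ᶜ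
  have hs : s.card = finrank F K - 3 := by
    have h4 : ({1, σ, σ ^ 2} : Finset (K ≃ₐ[F] K)).card = 3 :=
      Finset.card_eq_three.2 ⟨_, _, _, h1.symm, h2.symm, h3.symm, rfl⟩
    rw [Finset.card_compl, h4, ← Nat.card_eq_fintype_card, IsGalois.card_aut_eq_finrank]
  have heq : galoisCenter E σ ⊓ imageSubspace (galPerm B σ) (galoisCenter E σ) =
      Submodule.span K (Set.range fun g : s => E g) := by
    have hr : (Set.range fun g : s => E g) = E '' s := by
      ext; simp
    ext u
    rw [Submodule.mem_inf, mem_imageSubspace_galPerm, hr, Basis.mem_span_image, mem_galoisCenter,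
      mem_galoisCenter, hE.repr_galConj, hE.repr_galConj]
    simp only [inv_inv, mul_one, ← pow_two, map_eq_zero_iff _ (AlgEquiv.injective _)]
    constructor
    · rintro ⟨⟨ha, hb⟩, -, hc⟩ g hg
      rw [Finset.mem_coe, Finsupp.mem_support_iff] at hg
      simp only [s, Finset.coe_compl, Set.mem_compl_iff, Finset.mem_coe, Finset.mem_insert,
        Finset.mem_singleton]
      rintro (rfl | rfl | rfl) <;> contradiction
    · intro h
      have h5 : ∀ g ∉ s, E.repr u g = 0 := fun g hg => by
        by_contra hc
        exact hg (h (Finset.mem_coe.2 (Finsupp.mem_support_iff.2 hc)))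
      refine ⟨⟨h5 _ ?_, h5 _ ?_⟩, h5 _ ?_, h5 _ ?_⟩ <;> simp [s]
  rw [heq, ← hs, ← Fintype.card_coe]
  exact finrank_span_eq_card (E.linearIndependent.comp _ Subtype.val_injective)

/-- The span of a subgeometry hyperplane is Galois stable and proper, whereas the center contains `E
(σ ^ 2)`, whose conjugates span V. -/
theorem IsGaloisBasis.not_galoisCenter_le_spanPoints [IsGalois F K] (hE : IsGaloisBasis B E)
    (ht : 3 ≤ finrank F K) (hσ : Subgroup.zpowers σ = ⊤) (H : Set (Projectivization K V))
    (hH : IsSubgeometryHyperplane F (linearPoints K (Submodule.span F (Set.range B))) H) :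
    ¬ galoisCenter E σ ≤ spanPoints H := by
  intro hle
  obtain ⟨W', U, ⟨hdim, hW', -⟩, hUW, hU, rfl⟩ := hH
  obtain ⟨-, h2, h3⟩ := sq_ne_of_generator ht hσ
  have htop : spanPoints (linearPoints K U) = ⊤ := by
    refine hE.eq_top_of_stable (fun g v hv => galConj_mem_span_linearPoints B ?_ g hv)
      (hle (basis_mem_galoisCenter h2 h3))
    rw [hW']
    rintro _ ⟨u, hu0, hu, rfl⟩
    exact ⟨u, hu0, hUW hu, rfl⟩
  have := E.finiteDimensional_of_finite
  have : FiniteDimensional F V := Module.Finite.trans K V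
  have h := finrank_span_le_finrank (K := K) U
  rw [← spanPoints_linearPoints, htop, finrank_top] at h
  omega

end Center

end PseudoReg

/-! ### From conditions (ii) and (iii) to Galois bases; uniqueness of the basis. -/

namespace PseudoReg

open Module

variable {F K V ι : Type*} [Field F] [Field K] [Algebra F K] [AddCommGroup V] [Module K V]
  [Module F V] [IsScalarTower F K V] [Fintype ι] [FiniteDimensional F K]
  {B : Basis ι K V} {E E' : Basis (K ≃ₐ[F] K) K V} {σ τ : K ≃ₐ[F] K}

theorem finrank_imageSubspace_galPerm (B : Basis ι K V) (σ : K ≃ₐ[F] K) (N : Submodule K V) :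
    finrank K (imageSubspace (galPerm B σ) N) = finrank K N := by
  have h1 : (imageSubspace (galPerm B σ) N).restrictScalars F =
      (N.restrictScalars F).map (galConj B σ : V →ₗ[F] V) := by
    ext x
    rw [Submodule.restrictScalars_mem, mem_imageSubspace_galPerm]
    constructor
    · intro hx
      refine ⟨_, hx, ?_⟩
      change galConj B σ (galConj B σ⁻¹ x) = x
      rw [← galConj_mul_apply, mul_inv_cancel, galConj_one_apply]
    · rintro ⟨y, hy, rfl⟩
      change galConj B σ⁻¹ (galConj B σ y) ∈ N
      rwa [← galConj_mul_apply, inv_mul_cancel, galConj_one_apply]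
  have h2 : finrank F (imageSubspace (galPerm B σ) N) = finrank F N := by
    have h3 := congrArg (fun M : Submodule F V => finrank F M) h1
    rw [LinearEquiv.finrank_map_eq] at h3
    exact h3
  rw [← finrank_mul_finrank F K N, ← finrank_mul_finrank F K] at h2
  exact Nat.eq_of_mul_eq_mul_left finrank_pos h2

theorem mem_range_algebraMap_of_generator [IsGalois F K] (hσ : Subgroup.zpowers σ = ⊤) {x : K}
    (hx : σ x = x) : ∃ a : F, algebraMap F K a = x := by
  refine IntermediateField.mem_bot.1 ((IsGalois.mem_bot_iff_fixed _).2 fun g => ?_)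
  obtain ⟨i, -, rfl⟩ := exists_pow_lt_of_zpowers_eq_top hσ g
  rw [AlgEquiv.coe_pow]
  exact Function.iterate_fixed hx i

/-- The kernel of a functional which is multiplied by a scalar under Galois conjugation is spanned
by a hyperplane of the canonical subgeometry. -/
theorem exists_hyperplane_of_semiinvariant [IsGalois F K] {S : Set (Projectivization K V)}
    (hS : IsSubgeometryOf (Submodule.span F (Set.range B)) S) (hσ : Subgroup.zpowers σ = ⊤)
    (c : V →ₗ[K] K) (hc : c ≠ 0) (m : K) (hm : ∀ u, σ (c (galConj B σ⁻¹ u)) = m * c u) :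
    ∃ H, IsSubgeometryHyperplane F S H ∧ LinearMap.ker c ≤ spanPoints H := by
  have := B.finiteDimensional_of_finite
  have : FiniteDimensional F V := Module.Finite.trans K V
  obtain ⟨i0, hi0⟩ : ∃ i, c (B i) ≠ 0 := by
    by_contra! h
    exact hc (B.ext fun i => by simpa using h i)
  set W := Submodule.span F (Set.range B) with hW
  have hB : ∀ i, B i ∈ W := fun i => Submodule.subset_span ⟨i, rfl⟩
  have hm' : ∀ w ∈ W, σ (c w) = m * c w := fun w hw => by
    rw [← hm, galConj_apply_of_mem B _ hw]
  -- The ratio of two values of `c` on W is fixed by σ, hence lies in F; so `c` maps W onto an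
  -- F-line and its kernel in W is a hyperplane.
  have hratio : ∀ w ∈ W, ∃ a : F, c w = a • c (B i0) := by
    intro w hw
    obtain ⟨a, ha⟩ := mem_range_algebraMap_of_generator hσ (x := c w / c (B i0)) (by
      have h0 : m ≠ 0 := by
        rintro rfl
        have := hm' _ (hB i0)
        rw [zero_mul, map_eq_zero_iff _ σ.injective] at this
        exact hi0 this
      rw [map_div₀, hm' w hw, hm' _ (hB i0), mul_div_mul_left _ _ h0])
    exact ⟨a, by rw [Algebra.smul_def, ha, div_mul_cancel₀ _ hi0]⟩
  let cW : W →ₗ[F] K := (c.restrictScalars F).domRestrict W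
  have hrange : LinearMap.range cW = Submodule.span F {c (B i0)} := by
    apply le_antisymm
    · rintro _ ⟨w, rfl⟩
      obtain ⟨a, ha⟩ := hratio w w.2
      exact Submodule.mem_span_singleton.2 ⟨a, ha.symm⟩
    · rw [Submodule.span_singleton_le_iff_mem]
      exact ⟨⟨B i0, hB i0⟩, rfl⟩
  let U : Submodule F V := (LinearMap.ker cW).map W.subtype
  have hU : ∀ u ∈ W, c u = 0 → u ∈ U := fun u hu h0 => ⟨⟨u, hu⟩, h0, rfl⟩
  have hrank : finrank F U + 1 = finrank F W := by
    rw [← LinearMap.finrank_range_add_finrank_ker cW, hrange, finrank_span_singleton hi0,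
      Submodule.finrank_map_subtype_eq, add_comm]
  refine ⟨linearPoints K U, ⟨W, U, hS, Submodule.map_subtype_le _ _, hrank, rfl⟩, ?_⟩
  rw [spanPoints_linearPoints]
  intro v hv
  choose a ha using fun i => hratio _ (hB i)
  have h1 : v = ∑ i, B.repr v i • (B i - a i • B i0) := by
    have h2 : ∑ i, B.repr v i • a i • B i0 = 0 := by
      have h3 : (∑ i, B.repr v i * algebraMap F K (a i)) * c (B i0) = 0 := by
        rw [LinearMap.mem_ker] at hv
        rw [← hv]
        conv_rhs => rw [← B.sum_repr v]
        rw [map_sum, Finset.sum_mul]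
        refine Finset.sum_congr rfl fun i _ => ?_
        rw [map_smul, ha i, smul_eq_mul, Algebra.smul_def, mul_assoc]
      have h4 := (mul_eq_zero.1 h3).resolve_right hi0
      rw [← zero_smul K (B i0), ← h4, Finset.sum_smul]
      refine Finset.sum_congr rfl fun i _ => ?_
      rw [← algebraMap_smul K (a i), smul_smul]
    simp only [smul_sub, Finset.sum_sub_distrib]
    rw [h2, sub_zero, B.sum_repr]
  rw [h1]
  refine Submodule.sum_mem _ fun i _ => Submodule.smul_mem _ _ (Submodule.subset_span ?_)
  refine hU _ (sub_mem (hB i) (Submodule.smul_mem _ _ (hB i0))) ?_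
  have h5 : c (a i • B i0) = a i • c (B i0) := by
    rw [← algebraMap_smul K (a i), map_smul, algebraMap_smul]
  rw [map_sub, h5, ha, sub_self]

/-- `Γ` and its image under `σ⁻¹` span a space of dimension 2(t-2) - (t-3) = t-1, the kernel of a
functional `c`. Its conjugate `c'` also kills `Γ`. On W the values of `c'` are the σ-images of those
of `c`, so a rational zero of `c` lies in `Γ`. -/
theorem exists_galoisBasis_of_finrank_inf [IsGalois F K] {S : Set (Projectivization K V)}
    (hS : IsSubgeometryOf (Submodule.span F (Set.range B)) S) (ht : 3 ≤ finrank F K)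
    (hdim : finrank K V = finrank F K) (hσ : Subgroup.zpowers σ = ⊤) (Γ : Submodule K V)
    (hΓ : finrank K Γ = finrank F K - 2)
    (hSΓ : ∀ w ∈ Submodule.span F (Set.range B), w ∈ Γ → w = 0)
    (hinf : finrank K (Γ ⊓ imageSubspace (galPerm B σ) Γ : Submodule K V) = finrank F K - 3)
    (hH : ∀ H, IsSubgeometryHyperplane F S H → ¬ Γ ≤ spanPoints H) :
    ∃ E : Basis (K ≃ₐ[F] K) K V, IsGaloisBasis B E ∧ Γ = galoisCenter E σ := by
  have := B.finiteDimensional_of_finite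
  have hinf' : Γ ⊓ imageSubspace (galPerm B σ⁻¹) Γ =
      imageSubspace (galPerm B σ⁻¹) (Γ ⊓ imageSubspace (galPerm B σ) Γ) := by
    ext x
    have hx : galConj B σ⁻¹ (galConj B σ x) = x := by
      rw [← galConj_mul_apply, inv_mul_cancel, galConj_one_apply]
    simp only [Submodule.mem_inf, mem_imageSubspace_galPerm, inv_inv, hx]
    exact and_comm
  have hsum := Submodule.finrank_sup_add_finrank_inf_eq Γ (imageSubspace (galPerm B σ⁻¹) Γ)
  rw [hinf', finrank_imageSubspace_galPerm, finrank_imageSubspace_galPerm, hinf, hΓ] at hsum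
  have hlt : Γ ⊔ imageSubspace (galPerm B σ⁻¹) Γ < ⊤ := by
    rw [lt_top_iff_ne_top]
    intro h
    rw [h, finrank_top] at hsum
    omega
  obtain ⟨c, hc, hker⟩ := Submodule.exists_le_ker_of_lt_top _ hlt
  let c' : V →ₗ[K] K :=
    { toFun u := σ (c (galConj B σ⁻¹ u))
      map_add' u v := by rw [map_add, map_add, map_add]
      map_smul' a u := by
        have : σ (σ⁻¹ a) = a := by rw [← AlgEquiv.mul_apply, mul_inv_cancel]; rfl
        rw [galConj_smul, map_smul, smul_eq_mul, map_mul, this]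
        rfl }
  have hΓc : Γ ≤ LinearMap.ker c := le_sup_left.trans hker
  have hΓc' : Γ ≤ LinearMap.ker c' := by
    intro u hu
    have h1 : galConj B σ⁻¹ u ∈ imageSubspace (galPerm B σ⁻¹) Γ := by
      rw [mem_imageSubspace_galPerm, ← galConj_mul_apply, inv_mul_cancel, galConj_one_apply]
      exact hu
    have h2 : c (galConj B σ⁻¹ u) = 0 := hker (Submodule.mem_sup_right h1)
    change σ (c (galConj B σ⁻¹ u)) = 0
    rw [h2, map_zero]
  -- Otherwise `c'` is a multiple of `c`, and `ker c` is spanned by a subgeometry hyperplane that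
  -- would then contain `Γ`.
  have hne : ¬ LinearMap.ker c ≤ LinearMap.ker c' := by
    intro hle
    obtain ⟨v, hv⟩ : ∃ v, c v ≠ 0 := by
      by_contra! h
      exact hc (LinearMap.ext h)
    obtain ⟨H, hH1, hH2⟩ := exists_hyperplane_of_semiinvariant hS hσ c hc (c' v / c v) (by
      intro u
      change c' u = _
      have h1 : u - (c u / c v) • v ∈ LinearMap.ker c := by
        rw [LinearMap.mem_ker, map_sub, map_smul, smul_eq_mul, div_mul_cancel₀ _ hv, sub_self]
      have h2 := hle h1
      rw [LinearMap.mem_ker, map_sub, map_smul, smul_eq_mul, sub_eq_zero] at h2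
      rw [h2]
      ring)
    exact hH H hH1 (hΓc.trans hH2)
  have hΓeq : Γ = LinearMap.ker c ⊓ LinearMap.ker c' := by
    refine Submodule.eq_of_le_of_finrank_le (le_inf hΓc hΓc') ?_
    have h1 : LinearMap.ker c ⊓ LinearMap.ker c' < LinearMap.ker c := inf_lt_left.2 hne
    have h2 := Submodule.finrank_lt_finrank_of_lt h1
    have h3 : LinearMap.ker c < ⊤ := by
      rw [lt_top_iff_ne_top]
      exact fun h => hc (LinearMap.ker_eq_top.1 h)
    have h4 := Submodule.finrank_lt h3.ne
    omega
  obtain ⟨E, hE, hrepr⟩ := exists_galoisBasis_of_functional B hdim c (by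
    intro w hw hw0
    refine hSΓ w hw ?_
    rw [hΓeq]
    refine ⟨hw0, ?_⟩
    change σ (c (galConj B σ⁻¹ w)) = 0
    rw [galConj_apply_of_mem B _ hw, hw0, map_zero])
  refine ⟨E, hE, ?_⟩
  ext u
  rw [hΓeq, mem_galoisCenter, hrepr, hrepr, inv_one, galConj_one_apply]
  rfl

/-- A point whose partial orbit spans the center generates a Galois basis with the same center. -/
theorem exists_galoisBasis_of_orbitSpan [IsGalois F K] (hE : IsGaloisBasis B E)
    (ht : 3 ≤ finrank F K) (hσ : Subgroup.zpowers σ = ⊤) (hτ : Subgroup.zpowers τ = ⊤)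
    (v : V) (hv : v ≠ 0)
    (h : galoisCenter E σ =
      orbitSpan (galPerm B τ) (Projectivization.mk K v hv) (finrank F K - 2)) :
    ∃ E' : Basis (K ≃ₐ[F] K) K V, IsGaloisBasis B E' ∧ E' (τ ^ 2) = v ∧
      galoisCenter E σ = galoisCenter E' τ := by
  have hdim : finrank K V = finrank F K := by
    rw [finrank_eq_card_basis E, ← Nat.card_eq_fintype_card, IsGalois.card_aut_eq_finrank]
  obtain ⟨-, h2, h3⟩ := sq_ne_of_generator ht hσ
  have hstable : ∀ (g : K ≃ₐ[F] K), ∀ u ∈ Submodule.span K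
      (Set.range fun g : K ≃ₐ[F] K => galConj B g v), galConj B g u ∈ Submodule.span K
      (Set.range fun g : K ≃ₐ[F] K => galConj B g v) := by
    intro g u hu
    induction hu using Submodule.span_induction with
    | mem x hx =>
      obtain ⟨k, rfl⟩ := hx
      exact Submodule.subset_span ⟨g * k, galConj_mul_apply B g k v⟩
    | zero => rw [map_zero]; exact zero_mem _
    | add x y _ _ hx hy => rw [map_add]; exact add_mem hx hy
    | smul a x _ hx => rw [galConj_smul]; exact Submodule.smul_mem _ _ hx
  have hle : galoisCenter E σ ≤ Submodule.span K
      (Set.range fun g : K ≃ₐ[F] K => galConj B g v) := by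
    rw [h, orbitSpan_galPerm]
    refine Submodule.span_mono ?_
    rintro _ ⟨i, -, rfl⟩
    exact ⟨_, rfl⟩
  -- Thus equation (*) alone forces the full orbit to span, once `Γ` is known to be the center of
  -- some Galois basis.
  have htop := hE.eq_top_of_stable hstable (hle (basis_mem_galoisCenter h2 h3))
  obtain ⟨E', hE', hv'⟩ := exists_galoisBasis_of_vector B hdim v (τ ^ 2) htop.ge
  refine ⟨E', hE', hv', ?_⟩
  rw [h, hE'.galoisCenter_eq_orbitSpan ht hτ]
  simp only [hv']

/-- The case i = 0 kills the coordinates 1 and σ of `v`. For j ≥ 3, conjugation by σ^(t-j) moves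
coordinate σ^j to coordinate 1, and t-j < t-2. -/
theorem IsGaloisBasis.eq_smul_of_orbit_mem [IsGalois F K] (hE : IsGaloisBasis B E)
    (ht : 3 ≤ finrank F K) (hσ : Subgroup.zpowers σ = ⊤) {v : V}
    (h : ∀ i < finrank F K - 2, galConj B (σ ^ i) v ∈ galoisCenter E σ) :
    v = E.repr v (σ ^ 2) • E (σ ^ 2) := by
  classical
  refine E.ext_elem fun g => ?_
  obtain ⟨j, hj, rfl⟩ := exists_pow_lt_of_zpowers_eq_top hσ g
  rw [map_smul, Finsupp.smul_apply, E.repr_self, Finsupp.single_apply, smul_eq_mul]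
  by_cases hj2 : σ ^ 2 = σ ^ j
  · rw [if_pos hj2, mul_one, hj2]
  rw [if_neg hj2, mul_zero]
  have h0 := h 0 (by omega)
  rw [pow_zero, galConj_one_apply, mem_galoisCenter] at h0
  match j, hj, hj2 with
  | 0, _, _ => rw [pow_zero]; exact h0.1
  | 1, _, _ => rw [pow_one]; exact h0.2
  | 2, _, hj2 => exact absurd rfl hj2
  | j + 3, hj, _ =>
    have h1 := (h (finrank F K - (j + 3)) (by omega)).1
    change E.repr _ 1 = 0 at h1
    have h2 : σ ^ (finrank F K - (j + 3)) * σ ^ (j + 3) = 1 := by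
      rw [← pow_add, Nat.sub_add_cancel hj.le, ← orderOf_eq_finrank_of_zpowers_eq_top hσ,
        pow_orderOf_eq_one]
    rw [← h2, hE.repr_galConj_mul, map_eq_zero_iff _ (AlgEquiv.injective _)] at h1
    exact h1

/-- Two Galois bases with the same center have the same pair of distinguished coordinates. -/
theorem IsGaloisBasis.coord_eq_zero_of_galoisCenter_eq [IsGalois F K] (hE' : IsGaloisBasis B E')
    (hE : IsGaloisBasis B E) (ht : 3 ≤ finrank F K) (hσ : Subgroup.zpowers σ = ⊤)
    (h : galoisCenter E σ = galoisCenter E' τ) (hτ : τ ≠ 1) :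
    (∀ u, (E'.repr u τ = 0 → E.repr u σ = 0) ∧ (E'.repr u 1 = 0 → E.repr u 1 = 0)) ∨
    (∀ u, (E'.repr u τ = 0 → E.repr u 1 = 0) ∧ (E'.repr u 1 = 0 → E.repr u σ = 0)) := by
  obtain ⟨h1, h2, h3⟩ := sq_ne_of_generator ht hσ
  have hzero : ∀ g, g ≠ 1 → g ≠ σ → E'.repr (E g) 1 = 0 ∧ E'.repr (E g) τ = 0 := by
    intro g hg hg'
    rw [← mem_galoisCenter, ← h]
    exact basis_mem_galoisCenter hg hg'
  have hexp : ∀ (k : K ≃ₐ[F] K), (k = 1 ∨ k = τ) → ∀ u,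
      E'.repr u k = E.repr u 1 * E'.repr (E 1) k + E.repr u σ * E'.repr (E σ) k := by
    classical
    intro k hk u
    have : u - (E.repr u 1 • E 1 + E.repr u σ • E σ) ∈ galoisCenter E σ := by
      simp [h1, h1.symm]
    rw [h, mem_galoisCenter] at this
    have h4 : E'.repr (u - (E.repr u 1 • E 1 + E.repr u σ • E σ)) k = 0 := by
      rcases hk with rfl | rfl
      exacts [this.1, this.2]
    rw [map_sub, map_add, map_smul, map_smul, Finsupp.sub_apply, Finsupp.add_apply,
      Finsupp.smul_apply, Finsupp.smul_apply, sub_eq_zero] at h4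
    exact h4
  have hequi : ∀ g, E'.repr (E (τ * g)) τ = τ (E'.repr (E g) 1) := by
    intro g
    rw [← hE, ← hE'.repr_galConj_mul, mul_one]
  -- Both distinguished `E'`-coordinates are combinations of the `E`-coordinates 1 and σ.
  -- Conjugation by τ carries the first to the second, which restricts the support: what remains is
  -- τ = σ or τσ = 1.
  have hsub : ∀ g, E'.repr (E g) 1 ≠ 0 → τ * g = 1 ∨ τ * g = σ := by
    intro g hg
    by_contra! hc
    have := (hzero _ hc.1 hc.2).2
    rw [hequi, map_eq_zero_iff _ τ.injective] at this
    exact hg this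
  have hnz : ∀ k : K ≃ₐ[F] K, (k = 1 ∨ k = τ) →
      ¬ (E'.repr (E 1) k = 0 ∧ E'.repr (E σ) k = 0) := by
    rintro k hk ⟨ha, hb⟩
    have := hexp k hk (E' k)
    rw [ha, hb] at this
    simp at this
  by_cases ha : E'.repr (E 1) 1 = 0
  · right
    have hb : E'.repr (E σ) 1 ≠ 0 := fun hb => hnz 1 (Or.inl rfl) ⟨ha, hb⟩
    have hτσ : τ * σ = 1 := (hsub σ hb).resolve_right fun hc => hτ (by simpa using hc)
    have hd : E'.repr (E σ) τ = 0 := by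
      have h5 : τ * σ ^ 2 = σ := by rw [pow_two, ← mul_assoc, hτσ, one_mul]
      rw [← h5, hequi, (hzero _ h2 h3).1, map_zero]
    have hc : E'.repr (E 1) τ ≠ 0 := fun hc => hnz τ (Or.inr rfl) ⟨hc, hd⟩
    intro u
    rw [hexp τ (Or.inr rfl) u, hexp 1 (Or.inl rfl) u, ha, hd, mul_zero, mul_zero, add_zero,
      zero_add]
    exact ⟨fun h => (mul_eq_zero.1 h).resolve_right hc, fun h => (mul_eq_zero.1 h).resolve_right hb⟩
  · left
    have hτσ : τ = σ := by simpa [hτ] using hsub 1 ha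
    have hb : E'.repr (E σ) 1 = 0 := by
      by_contra hb
      rcases hsub σ hb with hc | hc
      · exact h2 (by rw [pow_two]; rwa [hτσ] at hc)
      · exact hτ (by simpa using hc)
    have hc : E'.repr (E 1) τ = 0 := by
      have h5 : τ * σ⁻¹ = 1 := by rw [hτσ, mul_inv_cancel]
      rw [← h5, hequi, (hzero _ (by simpa using h1) fun hc => h2 ?_).1, map_zero]
      rw [pow_two, mul_eq_one_iff_eq_inv, hc]
    have hd : E'.repr (E σ) τ ≠ 0 := fun hd => hnz τ (Or.inr rfl) ⟨hc, hd⟩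
    intro u
    rw [hexp τ (Or.inr rfl) u, hexp 1 (Or.inl rfl) u, hb, hc, mul_zero, mul_zero, add_zero,
      zero_add]
    exact ⟨fun h => (mul_eq_zero.1 h).resolve_right hd, fun h => (mul_eq_zero.1 h).resolve_right ha⟩

end PseudoReg

/-! ### The standard point set, projections, and linear sets of pseudoregulus type. -/

namespace PseudoReg

open Module

section Standard

variable {F K : Type*} [Field F] [Field K] [Algebra F K]

/-- The point set `{⟨(a, g a)⟩ | a ≠ 0}` of `PG_K(K²)`. -/
def galoisPoints (g : K ≃ₐ[F] K) : Set (Projectivization K (Fin 2 → K)) :=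
  {P | ∃ (a : K) (h : (![a, g a] : Fin 2 → K) ≠ 0), P = Projectivization.mk K _ h}

/-- For g = σ^n take z = y σ(y) ⋯ σ^(n-1)(y); the quotient σ(z)/z telescopes to g(y)/y. -/
theorem exists_mul_eq_of_mem_zpowers [FiniteDimensional F K] {σ g : K ≃ₐ[F] K}
    (hg : g ∈ Subgroup.zpowers σ) {y : K} (hy : y ≠ 0) : ∃ z : K, z ≠ 0 ∧ g y * z = σ z * y := by
  obtain ⟨n, rfl⟩ := (mem_powers_iff_mem_zpowers.2 hg : g ∈ Submonoid.powers σ)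
  induction n with
  | zero => exact ⟨1, one_ne_zero, by simp⟩
  | succ n ih =>
    obtain ⟨z, hz, h⟩ := ih (Subgroup.npow_mem_zpowers σ n)
    refine ⟨z * (σ ^ n) y, mul_ne_zero hz ((map_ne_zero_iff _ (AlgEquiv.injective _)).2 hy), ?_⟩
    have h1 : (σ ^ (n + 1)) y = σ ((σ ^ n) y) := by rw [pow_succ']; rfl
    rw [h1, map_mul]
    dsimp only at h
    linear_combination σ ((σ ^ n) y) * h

theorem galoisPoints_subset [FiniteDimensional F K] {σ g : K ≃ₐ[F] K}
    (hg : g ∈ Subgroup.zpowers σ) : galoisPoints g ⊆ galoisPoints σ := by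
  rintro _ ⟨y, hy, rfl⟩
  have hy0 : y ≠ 0 := by
    rintro rfl
    simp at hy
  obtain ⟨z, hz, h⟩ := exists_mul_eq_of_mem_zpowers hg hy0
  refine ⟨z, by simp [hz], ?_⟩
  rw [Projectivization.mk_eq_mk_iff']
  refine ⟨y / z, ?_⟩
  ext i
  fin_cases i
  · simp [hz]
  · have : y / z * σ z = g y := by
      field_simp
      linear_combination -h
    simpa using this

theorem exists_generator_standardPseudoregulus (F K : Type*) [Field F] [Finite F] [Field K]
    [Algebra F K] [FiniteDimensional F K] :
    ∃ φ : K ≃ₐ[F] K, Subgroup.zpowers φ = ⊤ ∧ (∀ x, φ x = x ^ Nat.card F) ∧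
      standardPseudoregulus F K = galoisPoints φ := by
  have := Fintype.ofFinite F
  have : Finite K := Module.finite_of_finite F
  have hpow : ∀ x, FiniteField.frobeniusAlgEquivOfAlgebraic F K x = x ^ Nat.card F := fun x => by
    rw [FiniteField.coe_frobeniusAlgEquivOfAlgebraic, Nat.card_eq_fintype_card]
  refine ⟨FiniteField.frobeniusAlgEquivOfAlgebraic F K, ?_, hpow, ?_⟩
  · rw [Subgroup.eq_top_iff']
    intro g
    obtain ⟨n, hn⟩ := (FiniteField.bijective_frobeniusAlgEquivOfAlgebraic_pow F K).2 g
    exact hn ▸ Subgroup.npow_mem_zpowers _ _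
  · simp only [standardPseudoregulus, galoisPoints, hpow]

theorem standardPseudoregulus_eq_galoisPoints [Finite F] [FiniteDimensional F K] {σ : K ≃ₐ[F] K}
    (hσ : Subgroup.zpowers σ = ⊤) : standardPseudoregulus F K = galoisPoints σ := by
  obtain ⟨φ, hφ, -, h⟩ := exists_generator_standardPseudoregulus F K
  rw [h]
  exact (galoisPoints_subset (hσ ▸ Subgroup.mem_top _)).antisymm
    (galoisPoints_subset (hφ ▸ Subgroup.mem_top _))

/-- The set is an injective image of the points of PG_F(K): proportional vectors (x, φ x) and (y, φ
y) have a ratio fixed by φ, hence in F. -/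
theorem ncard_standardPseudoregulus [Finite F] [FiniteDimensional F K] :
    (standardPseudoregulus F K).ncard = ∑ i ∈ Finset.range (finrank F K), Nat.card F ^ i := by
  obtain ⟨φ, hφ, -, h⟩ := exists_generator_standardPseudoregulus F K
  have : Finite K := Module.finite_of_finite F
  let f : K →ₛₗ[algebraMap F K] (Fin 2 → K) :=
    { toFun x := ![x, φ x]
      map_add' x y := by simp
      map_smul' a x := by
        ext i
        fin_cases i <;> simp [Algebra.smul_def] }
  have hf : Function.Injective f := fun x y hxy => congrFun hxy 0
  have hinj : Function.Injective (Projectivization.map f hf) := by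
    intro P Q hPQ
    induction P using Projectivization.ind with
    | h x hx =>
      induction Q using Projectivization.ind with
      | h y hy =>
        rw [Projectivization.map_mk, Projectivization.map_mk, Projectivization.mk_eq_mk_iff'] at hPQ
        obtain ⟨c, hc⟩ := hPQ
        have h0 : c * y = x := congrFun hc 0
        have h1 : c * φ y = φ x := congrFun hc 1
        have hcφ : φ c = c := by
          rw [← h0, map_mul] at h1
          exact (mul_right_cancel₀ ((map_ne_zero_iff _ φ.injective).2 hy) h1).symm
        obtain ⟨a, ha⟩ := mem_range_algebraMap_of_generator hφ hcφ
        rw [Projectivization.mk_eq_mk_iff']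
        exact ⟨a, by rw [Algebra.smul_def, ha, h0]⟩
  have hrange : standardPseudoregulus F K = Set.range (Projectivization.map f hf) := by
    rw [h]
    ext P
    constructor
    · rintro ⟨a, ha, rfl⟩
      have ha0 : a ≠ 0 := by
        rintro rfl
        simp at ha
      exact ⟨Projectivization.mk F a ha0, rfl⟩
    · rintro ⟨Q, rfl⟩
      induction Q using Projectivization.ind with
      | h y hy => exact ⟨y, by simp [hy], rfl⟩
  rw [hrange, ← Set.image_univ, Set.ncard_image_of_injective _ hinj, Set.ncard_univ,
    Projectivization.card_of_finrank F K rfl]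

end Standard

/-! ### Projection from the center as a linear map `π` onto `l` along `Γ`. -/

section Projection

variable {K V : Type*} [Field K] [AddCommGroup V] [Module K V] {Γ l : Submodule K V}
  {π : V →ₗ[K] V}

theorem sup_span_singleton_inf_eq (hlΓ : l ⊓ Γ = ⊥) (hl : ∀ u, π u ∈ l) (hΓ : ∀ u, u - π u ∈ Γ)
    (v : V) : (Γ ⊔ Submodule.span K {v}) ⊓ l = Submodule.span K {π v} := by
  apply le_antisymm
  · rintro x ⟨hx, hxl⟩
    obtain ⟨y, hy, z, hz, rfl⟩ := Submodule.mem_sup.1 hx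
    obtain ⟨c, rfl⟩ := Submodule.mem_span_singleton.1 hz
    refine Submodule.mem_span_singleton.2 ⟨c, ?_⟩
    have h1 : y + c • v - c • π v ∈ l ⊓ Γ := by
      refine ⟨sub_mem hxl (l.smul_mem _ (hl v)), ?_⟩
      rw [add_sub_assoc, ← smul_sub]
      exact add_mem hy (Γ.smul_mem _ (hΓ v))
    rw [hlΓ, Submodule.mem_bot, sub_eq_zero] at h1
    exact h1.symm
  · rw [Submodule.span_singleton_le_iff_mem]
    refine ⟨?_, hl v⟩
    rw [← sub_sub_cancel v (π v), sub_eq_add_neg, add_comm]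
    exact Submodule.add_mem_sup (neg_mem (hΓ v)) (Submodule.mem_span_singleton_self v)

theorem mem_center_iff (hlΓ : l ⊓ Γ = ⊥) (hl : ∀ u, π u ∈ l) (hΓ : ∀ u, u - π u ∈ Γ) (u : V) :
    u ∈ Γ ↔ π u = 0 := by
  constructor
  · intro hu
    have h1 : π u ∈ l ⊓ Γ := ⟨hl u, by simpa using sub_mem hu (hΓ u)⟩
    rwa [hlΓ] at h1
  · intro hu
    simpa [hu] using hΓ u

theorem projection_apply_eq_self (hlΓ : l ⊓ Γ = ⊥) (hl : ∀ u, π u ∈ l) (hΓ : ∀ u, u - π u ∈ Γ)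
    {u : V} (hu : u ∈ l) : π u = u := by
  have h1 : u - π u ∈ l ⊓ Γ := ⟨sub_mem hu (hl u), hΓ u⟩
  rw [hlΓ, Submodule.mem_bot, sub_eq_zero] at h1
  exact h1.symm

theorem projection_linearPoints {F : Type*} [Field F] [Module F V]
    [LinearMap.CompatibleSMul V V F K] (hlΓ : l ⊓ Γ = ⊥)
    (hl : ∀ u, π u ∈ l) (hΓ : ∀ u, u - π u ∈ Γ) (W : Submodule F V)
    (hW : ∀ w ∈ W, w ∈ Γ → w = 0) :
    projection Γ l (linearPoints K W) = linearPoints K (W.map (π.restrictScalars F)) := by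
  have hne : ∀ w ∈ W, w ≠ 0 → π w ≠ 0 := fun w hw hw0 h =>
    hw0 (hW w hw ((mem_center_iff hlΓ hl hΓ w).2 h))
  ext Q
  constructor
  · rintro ⟨_, ⟨w, hw0, hw, rfl⟩, hQ⟩
    rw [Projectivization.submodule_mk, sup_span_singleton_inf_eq hlΓ hl hΓ] at hQ
    refine ⟨π w, hne w hw hw0, ⟨w, hw, rfl⟩, Projectivization.submodule_injective ?_⟩
    rw [hQ, Projectivization.submodule_mk]
  · rintro ⟨_, hu0, ⟨w, hw, rfl⟩, rfl⟩
    have hw0 : w ≠ 0 := by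
      rintro rfl
      simp at hu0
    refine ⟨_, ⟨w, hw0, hw, rfl⟩, ?_⟩
    rw [Projectivization.submodule_mk, Projectivization.submodule_mk,
      sup_span_singleton_inf_eq hlΓ hl hΓ]
    rfl

theorem exists_coordinates (hl : ∀ u, π u ∈ l) (f : (Fin 2 → K) →ₗ[K] V)
    (hf : Function.Injective f) (hfl : LinearMap.range f = l) :
    ∃ a b : V →ₗ[K] K, ∀ u, π u = f ![a u, b u] := by
  let e := LinearEquiv.ofInjective f hf
  let π' : V →ₗ[K] LinearMap.range f := π.codRestrict _ fun u => hfl ▸ hl u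
  refine ⟨LinearMap.proj 0 ∘ₗ e.symm.toLinearMap ∘ₗ π',
    LinearMap.proj 1 ∘ₗ e.symm.toLinearMap ∘ₗ π', fun u => ?_⟩
  have h1 : ![e.symm (π' u) 0, e.symm (π' u) 1] = e.symm (π' u) := by
    ext i
    fin_cases i <;> rfl
  change π u = f ![e.symm (π' u) 0, e.symm (π' u) 1]
  rw [h1, ← LinearEquiv.ofInjective_apply (h := hf)]
  change _ = ((e (e.symm (π' u)) : LinearMap.range f) : V)
  rw [LinearEquiv.apply_symm_apply]
  rfl

end Projection

section PseudoregulusMap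

variable {F K V ι : Type*} [Field F] [Finite F] [Field K] [Algebra F K] [AddCommGroup V]
  [Module K V] [Module F V] [IsScalarTower F K V] [Fintype ι] [FiniteDimensional F K]
  {B : Basis ι K V} {E : Basis (K ≃ₐ[F] K) K V} {σ : K ≃ₐ[F] K} {Γ l : Submodule K V}
  {π : V →ₗ[K] V}

theorem map_mk_vec_eq {f : (Fin 2 → K) →ₗ[K] V} (hf : Function.Injective f)
    (v : Fin 2 → K) (hv : v ≠ 0) : Projectivization.map f hf (Projectivization.mk K v hv) =
      Projectivization.mk K (f v) ((map_ne_zero_iff f hf).2 hv) := rfl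

/-- In the frame `π (E 1)`, `π (E σ)` of `l`, the map `π` reads off the coordinates 1 and σ. A
rational vector gives (x, σ x), and every x in K occurs by comparing F-dimensions. -/
theorem IsGaloisBasis.exists_pseudoregulusMap (hE : IsGaloisBasis B E) (ht : 3 ≤ finrank F K)
    (hσ : Subgroup.zpowers σ = ⊤) (hΓE : Γ = galoisCenter E σ)
    (hlΓ : l ⊓ Γ = ⊥) (hl : ∀ u, π u ∈ l) (hΓ : ∀ u, u - π u ∈ Γ)
    (hW : finrank F (Submodule.span F (Set.range B)) = finrank F K) :
    ∃ (f : (Fin 2 → K) →ₗ[K] V) (hf : Function.Injective f),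
      IsPseudoregulusMap F l
        (linearPoints K ((Submodule.span F (Set.range B)).map (π.restrictScalars F))) f hf ∧
      f ![1, 0] = π (E 1) ∧ f ![0, 1] = π (E σ) := by
  classical
  have : Finite K := Module.finite_of_finite F
  obtain ⟨h1, -, -⟩ := sq_ne_of_generator ht hσ
  set W := Submodule.span F (Set.range B) with hWdef
  let f : (Fin 2 → K) →ₗ[K] V := (LinearMap.proj 0).smulRight (π (E 1)) +
    (LinearMap.proj 1).smulRight (π (E σ))
  have hfapp : ∀ x y, f ![x, y] = π (x • E 1 + y • E σ) := fun x y => by simp [f]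
  have hvec : ∀ x : Fin 2 → K, x = ![x 0, x 1] := fun x => by
    ext i; fin_cases i <;> rfl
  have hπ : ∀ u, π u = f ![E.repr u 1, E.repr u σ] := by
    intro u
    rw [hfapp, ← sub_eq_zero, ← map_sub, ← mem_center_iff hlΓ hl hΓ, hΓE]
    simp [h1, h1.symm]
  have hf : Function.Injective f := by
    rw [injective_iff_map_eq_zero]
    intro x hx
    rw [hvec x, hfapp, ← mem_center_iff hlΓ hl hΓ, hΓE, mem_galoisCenter] at hx
    simp [h1, h1.symm] at hx
    rw [hvec x, hx.1, hx.2]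
    simp
  refine ⟨f, hf, ⟨?_, ?_⟩, ?_, ?_⟩
  · apply le_antisymm
    · rintro _ ⟨x, rfl⟩
      rw [hvec x, hfapp]
      exact hl _
    · intro u hu
      rw [← projection_apply_eq_self hlΓ hl hΓ hu, hπ]
      exact LinearMap.mem_range_self _ _
  · have hsurj : ∀ x : K, ∃ w ∈ W, E.repr w 1 = x := by
      let a : W →ₗ[F] K := ((E.coord 1).restrictScalars F).domRestrict W
      have ha : Function.Injective a := by
        rw [injective_iff_map_eq_zero]
        intro w hw
        exact Subtype.ext (hE.eq_zero_of_mem w.2 hw)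
      have : FiniteDimensional F W := Module.finite_of_finrank_pos (by omega)
      intro x
      obtain ⟨w, hw⟩ := (LinearMap.injective_iff_surjective_of_finrank_eq_finrank hW).1 ha x
      exact ⟨w, w.2, hw⟩
    rw [standardPseudoregulus_eq_galoisPoints hσ]
    ext Q
    constructor
    · rintro ⟨_, ⟨x, hx, rfl⟩, rfl⟩
      obtain ⟨w, hw, rfl⟩ := hsurj x
      refine ⟨_, (map_ne_zero_iff f hf).2 hx, ⟨w, hw, ?_⟩, rfl⟩
      change π w = _
      rw [hπ, hE.repr_of_mem hw σ]
    · rintro ⟨_, hu0, ⟨w, hw, rfl⟩, rfl⟩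
      have h2 : π w = f ![E.repr w 1, σ (E.repr w 1)] := by rw [hπ, hE.repr_of_mem hw σ]
      have h3 : (![E.repr w 1, σ (E.repr w 1)] : Fin 2 → K) ≠ 0 := fun h0 => hu0 (by
        change π w = 0
        rw [h2, h0, map_zero])
      refine ⟨_, ⟨_, h3, rfl⟩, ?_⟩
      rw [map_mk_vec_eq, Projectivization.mk_eq_mk_iff']
      exact ⟨1, by rw [one_smul]; exact h2⟩
  · rw [hfapp]; simp
  · rw [hfapp]; simp

/-- The set of points of pseudoregulus type is scattered. -/
theorem isScatteredLinearSet_of_isPseudoregulusMap {W : Submodule F V} (hlΓ : l ⊓ Γ = ⊥) (hl : ∀ u, π u ∈ l) (hΓ : ∀ u, u - π u ∈ Γ)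
    (hW : finrank F W = finrank F K) (hWΓ : ∀ w ∈ W, w ∈ Γ → w = 0)
    {f : (Fin 2 → K) →ₗ[K] V} {hf : Function.Injective f}
    (h : IsPseudoregulusMap F l (linearPoints K (W.map (π.restrictScalars F))) f hf) :
    IsScatteredLinearSet F (finrank F K) (linearPoints K (W.map (π.restrictScalars F))) := by
  refine ⟨⟨_, ?_, rfl⟩, ?_⟩
  · have h1 : W.map (π.restrictScalars F) =
        LinearMap.range ((π.restrictScalars F).domRestrict W) := by
      rw [LinearMap.range_domRestrict]
    rw [h1, LinearMap.finrank_range_of_inj, hW]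
    rw [injective_iff_map_eq_zero]
    intro w hw
    exact Subtype.ext (hWΓ w w.2 ((mem_center_iff hlΓ hl hΓ _).2 hw))
  · rw [← h.2, Set.ncard_image_of_injective _ (Projectivization.map_injective f hf),
      ncard_standardPseudoregulus]

/-- The first coordinate `a` of `π` generates the Galois basis, and the eigenvalue criterion reduces
the second, `b`, to a multiple of one coordinate τ. The last two conclusions locate the transversal
points. -/
theorem exists_galoisBasis_of_pseudoregulusMap (ht : 3 ≤ finrank F K)
    (hdim : finrank K V = finrank F K)
    (hlΓ : l ⊓ Γ = ⊥) (hl : ∀ u, π u ∈ l) (hΓ : ∀ u, u - π u ∈ Γ)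
    (hWΓ : ∀ w ∈ Submodule.span F (Set.range B), w ∈ Γ → w = 0)
    {f : (Fin 2 → K) →ₗ[K] V} {hf : Function.Injective f}
    (h : IsPseudoregulusMap F l
      (linearPoints K ((Submodule.span F (Set.range B)).map (π.restrictScalars F))) f hf) :
    ∃ (E : Basis (K ≃ₐ[F] K) K V) (τ : K ≃ₐ[F] K), IsGaloisBasis B E ∧
      Subgroup.zpowers τ = ⊤ ∧ Γ = galoisCenter E τ ∧
      E.repr (f ![1, 0]) τ = 0 ∧ E.repr (f ![0, 1]) 1 = 0 := by
  classical
  have : Finite K := Module.finite_of_finite F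
  obtain ⟨hfl, hL⟩ := h
  set W := Submodule.span F (Set.range B) with hWdef
  obtain ⟨a, b, hab⟩ := exists_coordinates hl f hf hfl
  have hq : 1 < Nat.card F := Finite.one_lt_card
  have hΓab : ∀ u, u ∈ Γ ↔ a u = 0 ∧ b u = 0 := by
    intro u
    rw [mem_center_iff hlΓ hl hΓ, hab, map_eq_zero_iff f hf]
    constructor
    · intro h0
      exact ⟨congrFun h0 0, congrFun h0 1⟩
    · rintro ⟨h0, h1⟩
      rw [h0, h1]
      simp
  -- No point of the standard set has first coordinate 0.
  have ha : ∀ w ∈ W, a w = 0 → w = 0 := by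
    intro w hw haw
    by_contra hw0
    have hπw : π w ≠ 0 := fun h0 => hw0 (hWΓ w hw ((mem_center_iff hlΓ hl hΓ w).2 h0))
    have hmem : Projectivization.mk K (π w) hπw ∈
        linearPoints K (W.map (π.restrictScalars F)) := ⟨_, hπw, ⟨w, hw, rfl⟩, rfl⟩
    rw [← hL] at hmem
    obtain ⟨_, ⟨x, hx, rfl⟩, hxw⟩ := hmem
    rw [map_mk_vec_eq, Projectivization.mk_eq_mk_iff'] at hxw
    obtain ⟨c, hc⟩ := hxw
    rw [hab, ← map_smul] at hc
    have h0 : c * a w = x := congrFun (hf hc) 0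
    rw [haw, mul_zero] at h0
    subst h0
    exact hx (by simp; omega)
  obtain ⟨E, hE, hrepr⟩ := exists_galoisBasis_of_functional B hdim a ha
  have haE : ∀ u, E.repr u 1 = a u := fun u => by
    rw [hrepr, inv_one, galConj_one_apply]; rfl
  have hbE : ∀ u, b u = ∑ g, b (E g) * E.repr u g := by
    intro u
    conv_lhs => rw [← E.sum_repr u]
    rw [map_sum]
    refine Finset.sum_congr rfl fun g _ => ?_
    rw [map_smul, smul_eq_mul, mul_comm]
  obtain ⟨τ, hτ, hne, hzero⟩ := exists_generator_of_powers_eigenvalues (fun g => b (E g))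
    (by omega) (by
      intro x hx
      have hx' : (![x, x ^ Nat.card F] : Fin 2 → K) ≠ 0 := fun h0 => hx (congrFun h0 0)
      have hmem : Projectivization.map f hf (Projectivization.mk K _ hx') ∈
          linearPoints K (W.map (π.restrictScalars F)) := hL ▸ ⟨_, ⟨x, hx', rfl⟩, rfl⟩
      obtain ⟨_, hu0, ⟨w, hw, rfl⟩, hwx⟩ := hmem
      rw [map_mk_vec_eq, Projectivization.mk_eq_mk_iff'] at hwx
      obtain ⟨c, hc⟩ := hwx
      change c • π w = _ at hc
      rw [hab, ← map_smul] at hc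
      have h0 : c * a w = x := congrFun (hf hc) 0
      have h1 : c * b w = x ^ Nat.card F := congrFun (hf hc) 1
      have hc0 : c ≠ 0 := by
        rintro rfl
        exact hx (by rw [← h0, zero_mul])
      -- Since (a w, b w) is proportional to (x, x^q), the quotient b w / a w is x^(q-1).
      refine ⟨a w, fun haw => hx (by rw [← h0, haw, mul_zero]), ?_⟩
      have h2 : ∑ g, b (E g) * g (a w) = b w := by
        rw [hbE w]
        refine Finset.sum_congr rfl fun g _ => ?_
        rw [hE.repr_of_mem hw g, haE]
      rw [h2]
      apply mul_left_cancel₀ hc0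
      rw [h1, mul_left_comm, h0, ← pow_succ, Nat.sub_add_cancel hq.le])
  have hbτ : ∀ u, b u = b (E τ) * E.repr u τ := by
    intro u
    rw [hbE, Finset.sum_eq_single τ]
    · intro g _ hg
      rw [show b (E g) = 0 from hzero g hg, zero_mul]
    · simp
  have hbτ0 : ∀ u, E.repr u τ = 0 ↔ b u = 0 := by
    intro u
    rw [hbτ, mul_eq_zero]
    exact ⟨Or.inr, fun h => h.resolve_left hne⟩
  have hfab : ∀ x, ![a (f x), b (f x)] = x := by
    intro x
    apply hf
    rw [← hab, projection_apply_eq_self hlΓ hl hΓ (hfl ▸ LinearMap.mem_range_self f x)]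
  refine ⟨E, τ, hE, hτ, ?_, ?_, ?_⟩
  · ext u
    rw [hΓab, mem_galoisCenter, haE, hbτ0]
  · rw [hbτ0]
    exact congrFun (hfab _) 1
  · rw [haE]
    exact congrFun (hfab _) 0

end PseudoregulusMap

end PseudoReg

/-! ### Transversal points and the main theorem. -/

namespace PseudoReg

open Module

/-- The subspace defining a canonical subgeometry has a basis which is a basis of the whole
space. -/
theorem exists_basis_of_isSubgeometryOf {F K V : Type*} [Field F] [Field K] [Algebra F K]
    [AddCommGroup V] [Module K V] [Module F V] [IsScalarTower F K V] {W : Submodule F V}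
    {S : Set (Projectivization K V)} (hS : IsSubgeometryOf W S) (hpos : 0 < finrank K V) :
    ∃ B : Basis (Fin (finrank K V)) K V, Submodule.span F (Set.range B) = W := by
  obtain ⟨hW, rfl, htop⟩ := hS
  have : FiniteDimensional F W := Module.finite_of_finrank_pos (by omega)
  let b := finBasisOfFinrankEq F W hW
  have hspan : Submodule.span F (Set.range fun i => (b i : V)) = W := by
    have h1 : (Set.range fun i => (b i : V)) = W.subtype '' Set.range b := by
      rw [← Set.range_comp]; rfl
    rw [h1, Submodule.span_image, b.span_eq, Submodule.map_top, Submodule.range_subtype]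
  have hK : ⊤ ≤ Submodule.span K (Set.range fun i => (b i : V)) := by
    rw [← htop, spanPoints_linearPoints, Submodule.span_le]
    intro w hw
    rw [SetLike.mem_coe, ← hspan] at hw
    exact Submodule.span_le_restrictScalars F K _ hw
  refine ⟨basisOfTopLeSpanOfCardEqFinrank _ hK (by simp), ?_⟩
  rw [coe_basisOfTopLeSpanOfCardEqFinrank, hspan]

section

variable {F K V ι : Type*} [Field F] [Finite F] [Field K] [Algebra F K] [AddCommGroup V]
  [Module K V] [Module F V] [IsScalarTower F K V] [Fintype ι] [FiniteDimensional F K]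
  {B : Basis ι K V} {E : Basis (K ≃ₐ[F] K) K V} {σ : K ≃ₐ[F] K} {Γ l : Submodule K V}
  {π : V →ₗ[K] V}

theorem map_mem_axis {F : Type*} [Field F] {l : Submodule K V} {L : Set (Projectivization K V)}
    {f : (Fin 2 → K) →ₗ[K] V} {hf : Function.Injective f} (h : IsPseudoregulusMap F l L f hf)
    (x : Fin 2 → K) : f x ∈ l := h.1 ▸ LinearMap.mem_range_self f x

theorem span_singleton_eq_of_repr_eq_zero (hσ : σ ≠ 1) (hΓE : Γ = galoisCenter E σ)
    (hlΓ : l ⊓ Γ = ⊥) (hl : ∀ u, π u ∈ l) (hΓ : ∀ u, u - π u ∈ Γ) {x : V} (hx : x ∈ l)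
    (hx0 : x ≠ 0) :
    (E.repr x σ = 0 → Submodule.span K {x} = Submodule.span K {π (E 1)}) ∧
      (E.repr x 1 = 0 → Submodule.span K {x} = Submodule.span K {π (E σ)}) := by
  classical
  have h1 : x = E.repr x 1 • π (E 1) + E.repr x σ • π (E σ) := by
    conv_lhs => rw [← projection_apply_eq_self hlΓ hl hΓ hx]
    rw [← π.map_smul, ← π.map_smul, ← map_add, ← sub_eq_zero, ← map_sub, ← mem_center_iff hlΓ hl hΓ,
      hΓE]
    simp [hσ, hσ.symm]
  constructor
  · intro h0
    rw [h0, zero_smul, add_zero] at h1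
    have hne : E.repr x 1 ≠ 0 := fun h => hx0 (by rw [h1, h, zero_smul])
    conv_lhs => rw [h1]
    exact Submodule.span_singleton_smul_eq (IsUnit.mk0 _ hne) _
  · intro h0
    rw [h0, zero_smul, zero_add] at h1
    have hne : E.repr x σ ≠ 0 := fun h => hx0 (by rw [h1, h, zero_smul])
    conv_lhs => rw [h1]
    exact Submodule.span_singleton_smul_eq (IsUnit.mk0 _ hne) _

/-- Any other projectivity onto the set yields another Galois basis with the same center, and its
distinguished coordinates agree with those of `E` up to order and scalars; so the two points do not
depend on the projectivity. -/
theorem IsGaloisBasis.image_transversalPoints (hE : IsGaloisBasis B E) (ht : 3 ≤ finrank F K)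
    (hσ : Subgroup.zpowers σ = ⊤) (hΓE : Γ = galoisCenter E σ)
    (hlΓ : l ⊓ Γ = ⊥) (hl : ∀ u, π u ∈ l) (hΓ : ∀ u, u - π u ∈ Γ)
    (hW : finrank F (Submodule.span F (Set.range B)) = finrank F K)
    (hWΓ : ∀ w ∈ Submodule.span F (Set.range B), w ∈ Γ → w = 0) :
    Projectivization.submodule '' {T | IsTransversalPoint F l
        (linearPoints K ((Submodule.span F (Set.range B)).map (π.restrictScalars F))) T} =
      {Submodule.span K {π (E 1)}, Submodule.span K {π (E σ)}} := by
  have : Finite K := Module.finite_of_finite F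
  have hdim : finrank K V = finrank F K := by
    rw [finrank_eq_card_basis E, ← Nat.card_eq_fintype_card, IsGalois.card_aut_eq_finrank]
  have h1 := (sq_ne_of_generator ht hσ).1
  have hv1 : (![1, 0] : Fin 2 → K) ≠ 0 := by simp
  have hv2 : (![0, 1] : Fin 2 → K) ≠ 0 := by simp
  ext N
  constructor
  · rintro ⟨T, ⟨f, hf, hmap, hT⟩, rfl⟩
    obtain ⟨E', τ, hE', hτ, hΓE', h10, h01⟩ :=
      exists_galoisBasis_of_pseudoregulusMap ht hdim hlΓ hl hΓ hWΓ hmap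
    have hs1 := span_singleton_eq_of_repr_eq_zero h1 hΓE hlΓ hl hΓ (map_mem_axis hmap ![1, 0])
      ((map_ne_zero_iff f hf).2 hv1)
    have hs2 := span_singleton_eq_of_repr_eq_zero h1 hΓE hlΓ hl hΓ (map_mem_axis hmap ![0, 1])
      ((map_ne_zero_iff f hf).2 hv2)
    have hsub : T.submodule = Submodule.span K {f ![1, 0]} ∨
        T.submodule = Submodule.span K {f ![0, 1]} := by
      rcases hT with rfl | rfl
      · left; rw [map_mk_vec_eq, Projectivization.submodule_mk]
      · right; rw [map_mk_vec_eq, Projectivization.submodule_mk]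
    rcases hE'.coord_eq_zero_of_galoisCenter_eq hE ht hσ (hΓE ▸ hΓE')
      (sq_ne_of_generator ht hτ).1 with h | h
    · rcases hsub with h2 | h2
      · left; rw [h2, hs1.1 ((h _).1 h10)]
      · right; rw [h2, hs2.2 ((h _).2 h01)]; rfl
    · rcases hsub with h2 | h2
      · right; rw [h2, hs1.2 ((h _).1 h10)]; rfl
      · left; rw [h2, hs2.1 ((h _).2 h01)]
  · obtain ⟨f, hf, hmap, h10, h01⟩ := hE.exists_pseudoregulusMap ht hσ hΓE hlΓ hl hΓ hW
    rintro (rfl | rfl)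
    · refine ⟨_, ⟨f, hf, hmap, Or.inl rfl⟩, ?_⟩
      rw [map_mk_vec_eq, Projectivization.submodule_mk, h10]
    · refine ⟨_, ⟨f, hf, hmap, Or.inr rfl⟩, ?_⟩
      rw [map_mk_vec_eq, Projectivization.submodule_mk, h01]

end

end PseudoReg

open PseudoReg Module in
theorem theorem2p3 {F K V : Type*} [Field F] [Finite F] [Field K] [Algebra F K]
    [AddCommGroup V] [Module K V] [Module F V] [IsScalarTower F K V]
    (t : ℕ) (ht : 3 ≤ t) (hq : 2 < Nat.card F)
    (hK : Module.finrank F K = t) (hV : Module.finrank K V = t)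
    (S : Set (Projectivization K V)) (hS : PseudoReg.IsCanonicalSubgeometry F S)
    (Γ l : Submodule K V) (hΓ : Module.finrank K Γ = t - 2) (hl : Module.finrank K l = 2)
    (hSΓ : ∀ P ∈ S, ¬ P.submodule ≤ Γ) (hlΓ : l ⊓ Γ = ⊥) :
    List.TFAE [
      PseudoReg.IsScatteredLinearSet F t (PseudoReg.projection Γ l S) ∧
        PseudoReg.IsPseudoregulusType F l (PseudoReg.projection Γ l S),
      (∃ s : Equiv.Perm (Projectivization K V), PseudoReg.IsStabilizerGenerator S s ∧
          Module.finrank K (Γ ⊓ PseudoReg.imageSubspace s Γ : Submodule K V) = t - 3) ∧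
        ∀ H : Set (Projectivization K V), PseudoReg.IsSubgeometryHyperplane F S H →
          ¬ Γ ≤ PseudoReg.spanPoints H,
      ∃ (P : Projectivization K V) (s : Equiv.Perm (Projectivization K V)),
        PseudoReg.IsStabilizerGenerator S s ∧
        PseudoReg.orbitSpan s P t = ⊤ ∧ Γ = PseudoReg.orbitSpan s P (t - 2)] ∧
    (PseudoReg.IsScatteredLinearSet F t (PseudoReg.projection Γ l S) ∧
        PseudoReg.IsPseudoregulusType F l (PseudoReg.projection Γ l S) →
      ∀ s : Equiv.Perm (Projectivization K V), PseudoReg.IsStabilizerGenerator S s →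
        (∀ P P' : Projectivization K V, Γ = PseudoReg.orbitSpan s P (t - 2) →
          Γ = PseudoReg.orbitSpan s P' (t - 2) → P = P') ∧
        (∀ P : Projectivization K V, Γ = PseudoReg.orbitSpan s P (t - 2) →
          Projectivization.submodule ''
              {T | PseudoReg.IsTransversalPoint F l (PseudoReg.projection Γ l S) T} =
            {l ⊓ (Γ ⊔ ((s ^ (t - 2)) P).submodule),
              l ⊓ (Γ ⊔ ((s ^ (t - 1)) P).submodule)})) := by
  subst hK
  have : FiniteDimensional F K := Module.finite_of_finrank_pos (by omega)
  have : Finite K := Module.finite_of_finite F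
  have : FiniteDimensional K V := Module.finite_of_finrank_pos (by omega)
  obtain ⟨W, hWS⟩ := hS
  obtain ⟨B, hBW⟩ := exists_basis_of_isSubgeometryOf hWS (by omega)
  subst hBW
  have hS' := hWS
  obtain ⟨hW, rfl, -⟩ := hWS
  replace hW := hW.trans hV
  have hnt : Nontrivial (Fin (finrank K V)) := Fin.nontrivial_iff_two_le.2 (by omega)
  have hWΓ : ∀ w ∈ Submodule.span F (Set.range B), w ∈ Γ → w = 0 := by
    intro w hw hwΓ
    by_contra hw0
    exact hSΓ _ ⟨w, hw0, hw, rfl⟩ ((submodule_mk_le_iff hw0).2 hwΓ)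
  obtain ⟨π, hπl, hπΓ⟩ : ∃ π : V →ₗ[K] V, (∀ u, π u ∈ l) ∧ ∀ u, u - π u ∈ Γ := by
    have hc : IsCompl l Γ := by
      refine IsCompl.of_eq hlΓ (Submodule.eq_top_of_finrank_eq ?_)
      have := Submodule.finrank_sup_add_finrank_inf_eq l Γ
      rw [hlΓ, finrank_bot] at this
      omega
    exact ⟨Submodule.projection l Γ hc, Submodule.projection_apply_mem hc,
      Submodule.sub_projection_mem hc⟩
  rw [projection_linearPoints hlΓ hπl hπΓ _ hWΓ]
  simp only [isStabilizerGenerator_iff B]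
  -- The right side is the common reformulation of the three conditions. Scatteredness need not be
  -- carried along, as it follows from the size of the standard set.
  have k1 : (IsScatteredLinearSet F (finrank F K) (linearPoints K
        ((Submodule.span F (Set.range B)).map (π.restrictScalars F))) ∧
      IsPseudoregulusType F l (linearPoints K
        ((Submodule.span F (Set.range B)).map (π.restrictScalars F)))) ↔
      ∃ (E : Basis (K ≃ₐ[F] K) K V) (σ : K ≃ₐ[F] K), IsGaloisBasis B E ∧
        Subgroup.zpowers σ = ⊤ ∧ Γ = galoisCenter E σ := by
    constructor
    · rintro ⟨-, f, hf, hmap⟩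
      obtain ⟨E, τ, hE, hτ, hΓE, -⟩ :=
        exists_galoisBasis_of_pseudoregulusMap ht hV hlΓ hπl hπΓ hWΓ hmap
      exact ⟨E, τ, hE, hτ, hΓE⟩
    · rintro ⟨E, σ, hE, hσ, hΓE⟩
      obtain ⟨f, hf, hmap, -⟩ := hE.exists_pseudoregulusMap ht hσ hΓE hlΓ hπl hπΓ hW
      exact ⟨isScatteredLinearSet_of_isPseudoregulusMap hlΓ hπl hπΓ hW hWΓ hmap, f, hf, hmap⟩
  rw [k1]
  refine ⟨?_, ?_⟩
  · tfae_have 1 → 2 := by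
      rintro ⟨E, σ, hE, hσ, rfl⟩
      exact ⟨⟨_, ⟨σ, hσ, rfl⟩, hE.finrank_inf_imageSubspace ht hσ⟩,
        hE.not_galoisCenter_le_spanPoints ht hσ⟩
    tfae_have 2 → 1 := by
      rintro ⟨⟨_, ⟨σ, hσ, rfl⟩, hinf⟩, hH⟩
      obtain ⟨E, hE, hΓE⟩ :=
        exists_galoisBasis_of_finrank_inf hS' ht hV hσ Γ hΓ hWΓ hinf hH
      exact ⟨E, σ, hE, hσ, hΓE⟩
    tfae_have 1 → 3 := by
      rintro ⟨E, σ, hE, hσ, rfl⟩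
      exact ⟨_, _, ⟨σ, hσ, rfl⟩, hE.orbitSpan_eq_top hσ _, hE.galoisCenter_eq_orbitSpan ht hσ⟩
    tfae_have 3 → 1 := by
      rintro ⟨P, _, ⟨σ, hσ, rfl⟩, htop, hΓP⟩
      induction P using Projectivization.ind with
      | h v hv =>
        rw [orbitSpan_galPerm] at htop
        -- Index σ^2 is chosen so that the first t-2 conjugates of `v` are exactly the basis vectors
        -- of index other than 1 and σ.
        obtain ⟨E, hE, hEv⟩ := exists_galoisBasis_of_vector B hV v (σ ^ 2) (by
          rw [← htop]
          refine Submodule.span_mono ?_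
          rintro _ ⟨i, -, rfl⟩
          exact ⟨_, rfl⟩)
        refine ⟨E, σ, hE, hσ, ?_⟩
        rw [hΓP, hE.galoisCenter_eq_orbitSpan ht hσ]
        simp only [hEv]
    tfae_finish
  · rintro ⟨E, σ, hE, hσ, hΓE⟩ _ ⟨τ, hτ, rfl⟩
    have key : ∀ v (hv : v ≠ 0), Γ = orbitSpan (galPerm B τ) (Projectivization.mk K v hv)
        (finrank F K - 2) → ∃ E' : Basis (K ≃ₐ[F] K) K V, IsGaloisBasis B E' ∧
          E' (τ ^ 2) = v ∧ Γ = galoisCenter E' τ := by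
      rw [hΓE]
      exact fun v hv h => exists_galoisBasis_of_orbitSpan hE ht hσ hτ v hv h
    refine ⟨fun P P' hP hP' => ?_, fun P hP => ?_⟩
    · induction P using Projectivization.ind with
      | h v hv =>
        induction P' using Projectivization.ind with
        | h v' hv' =>
          obtain ⟨E', hE', rfl, hΓE'⟩ := key v hv hP
          have hsm := hE'.eq_smul_of_orbit_mem ht hτ (v := v') (fun i hi => by
            rw [← hΓE', hP', orbitSpan_galPerm]
            exact Submodule.subset_span ⟨i, hi, rfl⟩)
          rw [eq_comm, Projectivization.mk_eq_mk_iff']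
          exact ⟨_, hsm.symm⟩
    · induction P using Projectivization.ind with
      | h v hv =>
        obtain ⟨E', hE', rfl, hΓE'⟩ := key v hv hP
        have hpow : ∀ i, l ⊓ (Γ ⊔ ((galPerm B τ ^ i)
            (Projectivization.mk K (E' (τ ^ 2)) hv)).submodule) =
            Submodule.span K {π (E' (τ ^ i * τ ^ 2))} := by
          intro i
          rw [← map_pow, galPerm_mk, Projectivization.submodule_mk, inf_comm,
            sup_span_singleton_inf_eq hlΓ hπl hπΓ, hE']
        -- As τ has order t, the exponents t-2 and t-1 carry `E' (τ ^ 2)` to `E' 1` and `E' τ`,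
        -- whose projections are the transversal points.
        have h1 : τ ^ (finrank F K - 2) * τ ^ 2 = 1 := by
          rw [← pow_add, Nat.sub_add_cancel (by omega),
            ← orderOf_eq_finrank_of_zpowers_eq_top hτ, pow_orderOf_eq_one]
        have h2 : τ ^ (finrank F K - 1) * τ ^ 2 = τ := by
          rw [show finrank F K - 1 = 1 + (finrank F K - 2) by omega, pow_add, mul_assoc, h1,
            pow_one, mul_one]
        rw [hpow, hpow, h1, h2]
        exact hE'.image_transversalPoints ht hτ hΓE' hlΓ hπl hπΓ hW hWΓ
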